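/- Let $G$ be a finite simple graph, let $k_1,k_2,k_3\ge 0$ be integers, $k=k_1+k_2+k_3$, and let $M\subseteq V(G)$ satisfy $|M|\le k+1$ and $G-M$ chordal. A hole is an induced cycle on at least four vertices. A solution is a triple $(V_-,E_-,E_+)$ with $V_-\subseteq V(G)\setminus M$, $E_-$ a set of edges of $G$, $E_+$ a set of non-edges of $G$ (unordered pairs of distinct nonadjacent vertices), $|V_-|\le k_1$, $|E_-|\le k_2$, $|E_+|\le k_3$, such that deleting $V_-$ and $E_-$ and adding $E_+$ turns $G$ into a chordal graph. Let $H$ be a shortest hole of $G$, and assume $|H|\ge k+4$. Let $A$ be the set of vertices adjacent to all vertices of $H$, let $V_0=V(G)\setminus(M\cup A)$ and $G_0=G[V_0]$ (a chordal graph), and let $\mathcal T$ be any clique tree of $G_0$, i.e. a tree whose nodes (bags) are the maximal cliques of $G_0$ such that for each $x\in V_0$ the bags containing $x$ induce a connected subtree. Let $P=v_1\cdots v_p$ be a path of $H-M$, i.e. a connected component of $H-M$. Let $K_1,\dots,K_q$ be the path of $\mathcal T$ that connects the bags containing $v_1$ with the bags containing $v_p$ ($K_1$ is its only bag containing $v_1$,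 and $K_q$ its only bag containing $v_p$). Let $\mathcal T_1$ be the subtree of $\mathcal T-\{K_1,K_q\}$ containing all $K_\ell$ with $1<\ell<q$ (empty if there is no such $\ell$). Let $V_1$ consist of $v_1$, $v_p$, and all vertices that occur in a bag of $\mathcal T_1$ and lie in the connected component of $G_0$ containing $P$; let $V_2$ be the union of the vertex sets of all induced $v_1$–$v_p$ paths of $G_0$. A branch of $P$ is the vertex set $C$ of a connected component of $G[V_1\setminus V_2]$; it is near to $v\in P$ if there is an $\ell$ with $1<\ell<q$, $v\in K_\ell$ and $N(C)\cap V_0\subseteq K_\ell$. A vertex set $X$ is simplicial in $G$ if $N[X]$ induces a chordal subgraph and $N(X)$ a clique. A vertex $v$ of $P$ is a junction of $P$ if 1. some bag containing $v$ has a vertex adjacent to a vertex of $M\setminus A$; or 2. some branch near to $v$ has a vertex adjacent to a vertex of $M\setminus A$; or 3. some branch near to $v$ is not simplicial in $G$; or 4. some vertex of $N(v)\cap V_2$ is nonadjacent to some vertex of $A$. A segment of $H$ is a subpath $v_s\cdots v_t$ ($s<t$) of a path of $H-M$ such that $v_s$ and $v_t$ are junctions and no other vertex of it is one. Theorem. If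 $H$ has more than $|M|\cdot(12k^2+87k+75)$ segments, then either there is a vertex $v\notin M$ that belongs to $V_-$ for every solution $(V_-,E_-,E_+)$, or there is no solution. -/

import Mathlib

namespace ChordalEditing

variable {V : Type*}

/-! ### Holes, chordal graphs, editing sets -/

/-- A hole: an induced (chordless) cycle on at least four vertices, given as a closed walk.
Its length `H.length` is the number `|H|` of its vertices (and of its edges). -/
def IsHole {G : SimpleGraph V} {r : V} (H : G.Walk r r) : Prop :=
  H.IsCycle ∧ H.IsChordless ∧ 4 ≤ H.length

/-- A graph is chordal if it has no hole. -/
def IsChordal (G : SimpleGraph V) : Prop :=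
  ∀ (r : V) (H : G.Walk r r), ¬ IsHole H

/-- A shortest hole of `G`. -/
def IsShortestHole {G : SimpleGraph V} {r : V} (H : G.Walk r r) : Prop :=
  IsHole H ∧ ∀ (r' : V) (H' : G.Walk r' r'), IsHole H' → H.length ≤ H'.length

/-- `M` is a hole cover of `G`: the graph `G - M` is chordal. -/
def IsHoleCover (G : SimpleGraph V) (M : Finset V) : Prop :=
  IsChordal (G.induce {v | v ∉ M})

/-- The graph obtained from `G` by deleting the vertices `Vd`, deleting the edges `Ed` and adding
the edges `Ea`. -/
def edited (G : SimpleGraph V) (Vd : Finset V) (Ed Ea : Finset (Sym2 V)) :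
    SimpleGraph {v | v ∉ Vd} :=
  (G.deleteEdges (Ed : Set (Sym2 V)) ⊔
    SimpleGraph.fromEdgeSet (Ea : Set (Sym2 V))).induce {v | v ∉ Vd}

/-- `(Vd, Ed, Ea)` is a chordal editing set of `G`: `Ed` consists of edges of `G`, `Ea` consists of
non-edges of `G`, and the edited graph is chordal. -/
def IsChordalEditingSet (G : SimpleGraph V) (Vd : Finset V) (Ed Ea : Finset (Sym2 V)) : Prop :=
  (Ed : Set (Sym2 V)) ⊆ G.edgeSet ∧ (Ea : Set (Sym2 V)) ⊆ Gᶜ.edgeSet ∧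
    IsChordal (edited G Vd Ed Ea)

/-- `(Vd, Ed, Ea)` is a solution of the instance `(G, k₁, k₂, k₃, M)` of the compression problem:
a chordal editing set of size at most `(k₁, k₂, k₃)` which deletes no vertex of `M`. -/
def IsSolution (G : SimpleGraph V) (k₁ k₂ k₃ : ℕ) (M : Finset V)
    (Vd : Finset V) (Ed Ea : Finset (Sym2 V)) : Prop :=
  IsChordalEditingSet G Vd Ed Ea ∧ Vd.card ≤ k₁ ∧ Ed.card ≤ k₂ ∧ Ea.card ≤ k₃ ∧ Disjoint Vd M

/-! ### Neighborhoods, components, simplicial sets -/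

/-- The open neighborhood `N(X)` of a set `X` of vertices. -/
def nbhd (G : SimpleGraph V) (X : Set V) : Set V :=
  {z | z ∉ X ∧ ∃ x ∈ X, G.Adj x z}

/-- Some vertex of `X` is adjacent to some vertex of `Y`. -/
def AdjSets (G : SimpleGraph V) (X Y : Set V) : Prop :=
  ∃ x ∈ X, ∃ y ∈ Y, G.Adj x y

/-- Every vertex of `X` is adjacent to every vertex of `Y`. -/
def CompletelyConnected (G : SimpleGraph V) (X Y : Set V) : Prop :=
  ∀ x ∈ X, ∀ y ∈ Y, G.Adj x y

/-- `C` is the vertex set of a connected component of the subgraph of `G` induced by `S`. -/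
def IsComponent (G : SimpleGraph V) (S C : Set V) : Prop :=
  C ⊆ S ∧ (G.induce C).Connected ∧ ∀ c ∈ C, ∀ z ∈ S, G.Adj c z → z ∈ C

/-- `X` is simplicial in `G`: `N[X]` induces a chordal subgraph and `N(X)` induces a clique. -/
def IsSimplicialSet (G : SimpleGraph V) (X : Set V) : Prop :=
  IsChordal (G.induce (X ∪ nbhd G X)) ∧ G.IsClique (nbhd G X)

/-! ### Clique trees -/

/-- `K` is a maximal clique of the subgraph of `G` induced by `S`. -/
def IsBag (G : SimpleGraph V) (S K : Set V) : Prop :=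
  Maximal (fun L : Set V => L ⊆ S ∧ G.IsClique L) K

/-- The bags: the maximal cliques of the subgraph of `G` induced by `S`. -/
abbrev Bag (G : SimpleGraph V) (S : Set V) : Type _ := {K : Set V // IsBag G S K}

/-- `T` is a clique tree of the subgraph of `G` induced by `S`: a tree on the maximal cliques
in which, for every `x ∈ S`, the bags that contain `x` induce a connected subgraph. -/
def IsCliqueTree (G : SimpleGraph V) (S : Set V) (T : SimpleGraph (Bag G S)) : Prop :=
  T.IsTree ∧ ∀ x ∈ S, (T.induce {K : Bag G S | x ∈ K.1}).Connected

/-- `W` is the path of bags `K₁, …, K_q` connecting the subtree of the bags containing `a` with the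
subtree of the bags containing `b`: its first bag is the only one on it that contains `a`, and its
last bag is the only one on it that contains `b`. -/
def IsBagPath {G : SimpleGraph V} {S : Set V} {T : SimpleGraph (Bag G S)} (a b : V)
    {K L : Bag G S} (W : T.Walk K L) : Prop :=
  W.IsPath ∧ a ∈ K.1 ∧ b ∈ L.1 ∧
    (∀ B ∈ W.support, a ∈ B.1 → B = K) ∧ (∀ B ∈ W.support, b ∈ B.1 → B = L)

/-- The inner bags `K_ℓ`, `1 < ℓ < q`, of a path of bags `K₁, …, K_q`. -/
def innerBags {G : SimpleGraph V} {S : Set V} {T : SimpleGraph (Bag G S)}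
    {K L : Bag G S} (W : T.Walk K L) : Set (Bag G S) :=
  {B | B ∈ W.support ∧ B ≠ K ∧ B ≠ L}

/-- The subtree of `T - {K₁, K_q}` that contains the inner bags of the path `K₁, …, K_q`. -/
def innerSubtree {G : SimpleGraph V} {S : Set V} {T : SimpleGraph (Bag G S)}
    {K L : Bag G S} (W : T.Walk K L) : Set (Bag G S) :=
  {B | ∃ D ∈ innerBags W, ∃ R : T.Walk D B, K ∉ R.support ∧ L ∉ R.support}

/-! ### The vertex sets attached to a hole and to a path of the hole -/

/-- The set `A` of common neighbors of (all the vertices of) the hole `H`. -/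
def commonNbrs {G : SimpleGraph V} {r : V} (H : G.Walk r r) : Set V :=
  {a | ∀ h ∈ H.support, G.Adj a h}

/-- `V₀ = V(G) ∖ (M ∪ A)`. -/
def V0 {G : SimpleGraph V} (M : Finset V) {r : V} (H : G.Walk r r) : Set V :=
  {v | v ∉ M ∧ v ∉ commonNbrs H}

/-- `V₁` for a path of the hole with ends `a` and `b`: the ends together with all vertices in the
bags of the inner subtree that lie in the connected component of `a` in the subgraph of `G` induced
by `S` (which is to be `V₀`). -/
def V1 {G : SimpleGraph V} {S : Set V} {T : SimpleGraph (Bag G S)} (a b : V)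
    {K L : Bag G S} (W : T.Walk K L) : Set V :=
  {z | z = a ∨ z = b ∨
    ((∃ B ∈ innerSubtree W, z ∈ B.1) ∧ ∃ Q : G.Walk a z, ∀ u ∈ Q.support, u ∈ S)}

/-- `V₂` for a path of the hole with ends `a` and `b`: the union of the vertex sets of all induced
paths between `a` and `b` in the subgraph of `G` induced by `S` (which is to be `V₀`). -/
def V2 (G : SimpleGraph V) (S : Set V) (a b : V) : Set V :=
  {z | ∃ Q : G.Walk a b, Q.IsPath ∧ Q.IsChordless ∧ (∀ u ∈ Q.support, u ∈ S) ∧ z ∈ Q.support}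

/-- A branch: a connected component of the subgraph induced by `V₁ ∖ V₂`. -/
def IsBranch {G : SimpleGraph V} {S : Set V} {T : SimpleGraph (Bag G S)} (a b : V)
    {K L : Bag G S} (W : T.Walk K L) (C : Set V) : Prop :=
  IsComponent G (V1 a b W \ V2 G S a b) C

/-- `C` is a branch that is near to `v`: the neighborhood of `C` in `S` (which is to be `V₀`) is
contained in some inner bag `K_ℓ`, `1 < ℓ < q`, with `first(v) ≤ ℓ ≤ last(v)`, that is, in some
inner bag that contains `v`. -/
def IsBranchNear {G : SimpleGraph V} {S : Set V} (T : SimpleGraph (Bag G S)) (a b v : V)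
    (C : Set V) : Prop :=
  ∃ (K L : Bag G S) (W : T.Walk K L), IsBagPath a b W ∧ IsBranch a b W C ∧
    ∃ D ∈ innerBags W, v ∈ D.1 ∧ nbhd G C ∩ S ⊆ D.1

/-! ### Junctions and segments -/

/-- `P` is one of the paths of `H - M`: a path whose vertex set is a connected component of
`H - M`. -/
def IsPathOfHole {G : SimpleGraph V} (M : Finset V) {r : V} (H : G.Walk r r)
    {a b : V} (P : G.Walk a b) : Prop :=
  P.IsPath ∧ IsComponent G {v | v ∈ H.support ∧ v ∉ M} {v | v ∈ P.support}

/-- The vertex `v` of a path of `H - M` with ends `a` and `b` is a junction of that path. Here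
`M ∖ A_M = M ∖ A`. -/
def IsJunction {G : SimpleGraph V} (M : Finset V) {r : V} (H : G.Walk r r)
    (T : SimpleGraph (Bag G (V0 M H))) (a b v : V) : Prop :=
  (∃ B : Bag G (V0 M H), v ∈ B.1 ∧ AdjSets G B.1 (↑M \ commonNbrs H)) ∨
  (∃ C : Set V, IsBranchNear T a b v C ∧ AdjSets G C (↑M \ commonNbrs H)) ∨
  (∃ C : Set V, IsBranchNear T a b v C ∧ ¬ IsSimplicialSet G C) ∨
  ¬ CompletelyConnected G {z | z ∈ V2 G (V0 M H) a b ∧ G.Adj v z} (commonNbrs H)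

/-- `X` is (the vertex set of) a segment of `H`: a subpath `v_s ⋯ v_t`, `s < t`, of a path
of `H - M` such that `v_s` and `v_t` are the only junctions in it. -/
def IsSegment {G : SimpleGraph V} (M : Finset V) {r : V} (H : G.Walk r r)
    (T : SimpleGraph (Bag G (V0 M H))) (X : Set V) : Prop :=
  ∃ (a b : V) (P : G.Walk a b), IsPathOfHole M H P ∧
    ∃ s t : ℕ, s < t ∧ t ≤ P.length ∧
      (∀ i, s ≤ i → i ≤ t → (IsJunction M H T a b (P.getVert i) ↔ i = s ∨ i = t)) ∧
      X = {v | ∃ i, s ≤ i ∧ i ≤ t ∧ v = P.getVert i}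

end ChordalEditing

namespace ChordalEditing

variable {V : Type*}

/-! ### Holes and induced paths as sequences of vertices -/

/-! If no single edit can destroy two holes of a family, then a solution needs at least as many
edits as the family has members (`IsChordalEditingSet.card_le`); so k + 1 such holes exclude a
solution. Junctions supply such families.

Number H cyclically from a vertex of M. The paths of H - M become intervals of indices, each
determined by the vertex of M just before it, so there are at most |M| of them. Segments inject into
junctions via their left ends, hence one path h l, …, h r has more than 12k² + 87k + 75 junctions.

Two facts localize everything. As H is shortest, a vertex outside A sees only three consecutive
indices of H, up to wrap-around (`IsShortestHoleSeq.sub_le_two`). As G - M is chordal, a connected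
part of V₀ touching the path on both sides of an inner vertex must meet the closed neighborhood of
that vertex (`HoleSetting.exists_eq_or_adj`). Thus connected sets attached to distant path vertices
("pods") are disjoint and nonadjacent.

A junction away from the ends yields (`cases_of_isJunction`) one of the following. (1) A pod
adjacent to some x in M \ A. Two distant pods of the same x, the path between them and x contain a
hole if x has no neighbor on that stretch. More than 9k + 15 such junctions give k + 1 holes sharing
only the undeletable x. (2) A hole inside a pod and A with at most one vertex in A \ M. Among k² + k
+ 1 disjoint pods, either one vertex of A \ M lies in more than k of these holes, and every solution
deletes it, or at most k deleted vertices hit at most k² of them and k + 1 others remain. This needs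
that edits inside the clique A are vertex deletions only (`not_mem_of_common`). (3) A hole
consisting of vertices close to the junction and one vertex of A, which lies in M. More than 9k such
junctions give k + 1 holes meeting only in undeletable vertices. With 10 junctions discarded near
the ends, these bounds add up to 12k² + 36k + 25. -/

/-- The vertices `h 0, …, h (n - 1)` form, in this cyclic order, an induced cycle of length
at least four. -/
structure IsHoleSeq (G : SimpleGraph V) (n : ℕ) (h : ℕ → V) : Prop where
  four_le : 4 ≤ n
  inj : ∀ i < n, ∀ j < n, h i = h j → i = j
  adj_iff : ∀ i < n, ∀ j < n,
    (G.Adj (h i) (h j) ↔ i + 1 = j ∨ j + 1 = i ∨ (i = 0 ∧ j + 1 = n) ∨ (j = 0 ∧ i + 1 = n))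

/-- The vertices `f 0, …, f m` form, in this order, an induced path. -/
structure IsPathSeq (G : SimpleGraph V) (m : ℕ) (f : ℕ → V) : Prop where
  inj : ∀ i ≤ m, ∀ j ≤ m, f i = f j → i = j
  adj_iff : ∀ i ≤ m, ∀ j ≤ m, (G.Adj (f i) (f j) ↔ i + 1 = j ∨ j + 1 = i)

/-- Some hole of `G` has all its vertices in `U`. -/
def HasHoleIn (G : SimpleGraph V) (U : Set V) : Prop :=
  ∃ (n : ℕ) (g : ℕ → V), IsHoleSeq G n g ∧ ∀ i < n, g i ∈ U

theorem HasHoleIn.mono {G : SimpleGraph V} {U U' : Set V} (h : HasHoleIn G U) (hU : U ⊆ U') :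
    HasHoleIn G U' := by
  obtain ⟨n, g, hg, hgU⟩ := h
  exact ⟨n, g, hg, fun i hi => hU (hgU i hi)⟩

theorem exists_walk_of_seq {G : SimpleGraph V} (f : ℕ → V) (m : ℕ)
    (hf : ∀ i < m, G.Adj (f i) (f (i + 1))) {u v : V} (hu : u = f 0) (hv : v = f m) :
    ∃ W : G.Walk u v, W.length = m ∧ ∀ i ≤ m, W.getVert i = f i := by
  subst hu
  induction m generalizing v with
  | zero =>
    subst hv
    refine ⟨.nil, rfl, fun i hi => ?_⟩
    obtain rfl : i = 0 := by omega
    rfl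
  | succ m ih =>
    subst hv
    obtain ⟨W, hW, hWf⟩ := ih (fun i hi => hf i (by omega)) rfl
    refine ⟨W.append (.cons (hf m (by omega)) .nil), by simp [hW], fun i hi => ?_⟩
    rw [SimpleGraph.Walk.getVert_append]
    split_ifs with h
    · exact hWf i (by omega)
    · obtain rfl | rfl : i = m ∨ i = m + 1 := by omega
      · simp [hW]
      · simp [hW]

theorem mk_mem_edges_iff {G : SimpleGraph V} {u v x y : V} (W : G.Walk u v) :
    s(x, y) ∈ W.edges ↔ ∃ i < W.length, s(W.getVert i, W.getVert (i + 1)) = s(x, y) := by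
  rw [← SimpleGraph.Walk.adj_toSubgraph_iff_mem_edges, SimpleGraph.Walk.toSubgraph_adj_iff]
  exact ⟨fun ⟨i, h1, h2⟩ => ⟨i, h2, h1⟩, fun ⟨i, h1, h2⟩ => ⟨i, h2, h1⟩⟩

theorem IsHoleSeq.exists_walk {G : SimpleGraph V} {n : ℕ} {h : ℕ → V} (hh : IsHoleSeq G n h) :
    ∃ W : G.Walk (h 0) (h 0), IsHole W ∧ W.length = n ∧ ∀ v ∈ W.support, ∃ i < n, v = h i := by
  have h4 := hh.four_le
  -- Reducing the index modulo `n` closes the walk: index `n` returns to `h 0`.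
  obtain ⟨W, hl, hW⟩ := exists_walk_of_seq (G := G) (fun i => h (i % n)) n (fun i hi => by
    have h1 : i % n = i := Nat.mod_eq_of_lt hi
    rcases Nat.lt_or_ge (i + 1) n with h2 | h2
    · have h3 : (i + 1) % n = i + 1 := Nat.mod_eq_of_lt h2
      simp only [h1, h3]
      rw [hh.adj_iff _ hi _ h2]; omega
    · have h3 : i + 1 = n := by omega
      simp only [h1, h3, Nat.mod_self]
      rw [hh.adj_iff _ hi _ (by omega)]; omega) (u := h 0) (v := h 0) (by simp) (by simp)
  have hlt : ∀ i < n, W.getVert i = h i := fun i hi => by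
    rw [hW i hi.le, Nat.mod_eq_of_lt hi]
  have hn : W.getVert n = h 0 := by rw [hW n le_rfl, Nat.mod_self]
  have hsup : ∀ v ∈ W.support, ∃ i < n, v = h i := by
    intro v hv
    obtain ⟨i, rfl, hi⟩ := SimpleGraph.Walk.mem_support_iff_exists_getVert.1 hv
    rcases Nat.lt_or_ge i n with h2 | h2
    · exact ⟨i, h2, hlt i h2⟩
    · obtain rfl : i = n := by omega
      exact ⟨0, by omega, hn⟩
  refine ⟨W, ⟨?_, ?_, by omega⟩, hl, hsup⟩
  · rw [SimpleGraph.Walk.isCycle_iff_isPath_tail_and_le_length]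
    refine ⟨?_, by omega⟩
    rw [← SimpleGraph.Walk.IsPath.getVert_injOn_iff]
    have htl : W.tail.length + 1 = n := by
      rw [SimpleGraph.Walk.length_tail_add_one, hl]
      rw [SimpleGraph.Walk.not_nil_iff_lt_length]; omega
    intro i hi j hj hij
    simp only [Set.mem_ofPred_eq, SimpleGraph.Walk.getVert_tail] at hi hj hij
    have key : ∀ i, i + 1 ≤ n → W.getVert (i + 1) = h (if i + 1 = n then 0 else i + 1) := by
      intro i hi
      split_ifs with h2
      · rw [h2, hn]
      · exact hlt _ (by omega)
    rw [key i (by omega), key j (by omega)] at hij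
    have := hh.inj _ (by split_ifs <;> omega) _ (by split_ifs <;> omega) hij
    split_ifs at this <;> omega
  · rw [SimpleGraph.Walk.isChordless_iff_forall_mem_edges]
    have key : ∀ i < n, ∀ j < n, G.Adj (h i) (h j) → i < j → s(h i, h j) ∈ W.edges := by
      intro i hi j hj hadj hij
      rw [mk_mem_edges_iff, hl]
      rcases (hh.adj_iff i hi j hj).1 hadj with h1 | h1 | h1 | h1
      · exact ⟨i, hi, by rw [hlt i hi, h1, hlt j hj]⟩
      · omega
      · exact ⟨j, hj, by rw [hlt j hj, h1.2, hn, h1.1, Sym2.eq_swap]⟩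
      · omega
    intro u' v' hu hv hadj
    obtain ⟨i, hi, rfl⟩ := hsup _ hu
    obtain ⟨j, hj, rfl⟩ := hsup _ hv
    rcases lt_trichotomy i j with h1 | h1 | h1
    · exact key i hi j hj hadj h1
    · subst h1; exact absurd hadj (G.loopless.irrefl _)
    · rw [Sym2.eq_swap]; exact key j hj i hi hadj.symm h1

theorem IsHole.isHoleSeq {G : SimpleGraph V} {r : V} {H : G.Walk r r} (hH : IsHole H) :
    IsHoleSeq G H.length H.getVert := by
  obtain ⟨hc, hl, h4⟩ := hH
  have hinj : ∀ i < H.length, ∀ j < H.length, H.getVert i = H.getVert j → i = j := by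
    intro i hi j hj hij
    exact hc.getVert_injOn' (by simp only [Set.mem_ofPred_eq]; omega)
      (by simp only [Set.mem_ofPred_eq]; omega) hij
  have hend : H.getVert H.length = H.getVert 0 := by simp
  have hsucc : ∀ i < H.length, H.getVert (i + 1) =
      H.getVert (if i + 1 = H.length then 0 else i + 1) := by
    intro i hi
    split_ifs with h
    · rw [h, hend]
    · rfl
  refine ⟨h4, hinj, fun i hi j hj => ⟨fun hadj => ?_, fun h => ?_⟩⟩
  · have := hl.mem_edges (H.getVert_mem_support i) (H.getVert_mem_support j) hadj
    rw [mk_mem_edges_iff] at this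
    obtain ⟨t, ht, hs⟩ := this
    rw [Sym2.eq_iff, hsucc t ht] at hs
    rcases hs with ⟨h1, h2⟩ | ⟨h1, h2⟩
    · have e1 := hinj _ ht _ hi h1
      have e2 := hinj _ (by split_ifs <;> omega) _ hj h2
      split_ifs at e2 <;> omega
    · have e1 := hinj _ ht _ hj h1
      have e2 := hinj _ (by split_ifs <;> omega) _ hi h2
      split_ifs at e2 <;> omega
  · rcases h with h | h | h | h
    · subst h; exact H.adj_getVert_succ hi
    · subst h; exact (H.adj_getVert_succ hj).symm
    · have := H.adj_getVert_succ hj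
      rw [h.2, hend] at this
      rw [h.1]; exact this.symm
    · have := H.adj_getVert_succ hi
      rw [h.2, hend] at this
      rw [h.1]; exact this

theorem IsHoleSeq.of_comap {V' : Type*} {G : SimpleGraph V} {G' : SimpleGraph V'} {n : ℕ}
    {h : ℕ → V} {h' : ℕ → V'} (hh : IsHoleSeq G n h)
    (heq : ∀ i < n, ∀ j < n, h' i = h' j → h i = h j)
    (hadj : ∀ i < n, ∀ j < n, (G'.Adj (h' i) (h' j) ↔ G.Adj (h i) (h j))) : IsHoleSeq G' n h' :=
  ⟨hh.four_le, fun i hi j hj e => hh.inj i hi j hj (heq i hi j hj e),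
    fun i hi j hj => (hadj i hi j hj).trans (hh.adj_iff i hi j hj)⟩

theorem isChordal_iff {G : SimpleGraph V} : IsChordal G ↔ ∀ n h, ¬ IsHoleSeq G n h := by
  constructor
  · intro hG n h hh
    obtain ⟨W, hW, -⟩ := hh.exists_walk
    exact hG _ W hW
  · intro hG r H hH
    exact hG _ _ hH.isHoleSeq

theorem isChordal_induce_iff {G : SimpleGraph V} {U : Set V} :
    IsChordal (G.induce U) ↔ ¬ HasHoleIn G U := by
  rw [isChordal_iff]
  constructor
  · rintro hG ⟨n, g, hg, hgU⟩
    have h4 := hg.four_le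
    -- Only values below `n` are known to lie in `U`; the reduction modulo `n` makes the sequence
    -- total in the subtype.
    refine hG n (fun i => ⟨g (i % n), hgU _ (Nat.mod_lt _ (by omega))⟩)
      (hg.of_comap (fun i hi j hj e => ?_) (fun i hi j hj => ?_))
    · simpa [Nat.mod_eq_of_lt hi, Nat.mod_eq_of_lt hj] using e
    · simp [Nat.mod_eq_of_lt hi, Nat.mod_eq_of_lt hj]
  · intro hG n h hh
    exact hG ⟨n, fun i => (h i : V), hh.of_comap (fun i hi j hj e => Subtype.ext e)
      (fun i hi j hj => by simp), fun i _ => (h i).2⟩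

theorem IsPathSeq.exists_walk {G : SimpleGraph V} {m : ℕ} {f : ℕ → V} (hf : IsPathSeq G m f)
    {u v : V} (hu : u = f 0) (hv : v = f m) :
    ∃ W : G.Walk u v, W.IsPath ∧ W.IsChordless ∧ (∀ x, x ∈ W.support ↔ ∃ i ≤ m, x = f i) := by
  obtain ⟨W, hl, hW⟩ := exists_walk_of_seq (G := G) f m
    (fun i hi => (hf.adj_iff i hi.le (i + 1) hi).2 (Or.inl rfl)) hu hv
  have hsup : ∀ x, x ∈ W.support ↔ ∃ i ≤ m, x = f i := by
    intro x
    rw [SimpleGraph.Walk.mem_support_iff_exists_getVert, hl]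
    constructor
    · rintro ⟨i, rfl, hi⟩; exact ⟨i, hi, hW i hi⟩
    · rintro ⟨i, hi, rfl⟩; exact ⟨i, hW i hi, hi⟩
  refine ⟨W, ?_, ?_, hsup⟩
  · rw [← SimpleGraph.Walk.IsPath.getVert_injOn_iff, hl]
    intro i hi j hj hij
    simp only [Set.mem_ofPred_eq] at hi hj
    rw [hW i hi, hW j hj] at hij
    exact hf.inj i hi j hj hij
  · rw [SimpleGraph.Walk.isChordless_iff_forall_mem_edges]
    intro x y hx hy hxy
    obtain ⟨i, hi, rfl⟩ := (hsup x).1 hx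
    obtain ⟨j, hj, rfl⟩ := (hsup y).1 hy
    rw [mk_mem_edges_iff, hl]
    rcases (hf.adj_iff i hi j hj).1 hxy with h | h
    · exact ⟨i, by omega, by rw [hW i hi, h, hW j hj]⟩
    · exact ⟨j, by omega, by rw [hW j hj, h, hW i hi, Sym2.eq_swap]⟩

theorem isPathSeq_getVert {G : SimpleGraph V} {u v : V} {W : G.Walk u v} (hp : W.IsPath)
    (hc : W.IsChordless) : IsPathSeq G W.length W.getVert := by
  have hinj : ∀ i ≤ W.length, ∀ j ≤ W.length, W.getVert i = W.getVert j → i = j :=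
    fun i hi j hj hij => hp.getVert_injOn hi hj hij
  refine ⟨hinj, fun i hi j hj => ⟨fun hadj => ?_, fun h => ?_⟩⟩
  · have := hc.mem_edges (W.getVert_mem_support i) (W.getVert_mem_support j) hadj
    rw [mk_mem_edges_iff] at this
    obtain ⟨t, ht, hs⟩ := this
    rw [Sym2.eq_iff] at hs
    rcases hs with ⟨h1, h2⟩ | ⟨h1, h2⟩
    · have e1 := hinj _ ht.le _ hi h1
      have e2 := hinj _ ht _ hj h2
      omega
    · have e1 := hinj _ ht.le _ hj h1
      have e2 := hinj _ ht _ hi h2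
      omega
  · rcases h with h | h
    · subst h; exact W.adj_getVert_succ hj
    · subst h; exact (W.adj_getVert_succ hi).symm

/-! ### Constructing holes -/

/-- The vertices `p` and `q` are joined by a walk inside `U`. -/
def Linked (G : SimpleGraph V) (U : Set V) (p q : V) : Prop :=
  ∃ W : G.Walk p q, ∀ u ∈ W.support, u ∈ U

theorem Linked.refl {G : SimpleGraph V} {U : Set V} {p : V} (hp : p ∈ U) : Linked G U p p :=
  ⟨.nil, by simpa using hp⟩

theorem Linked.symm {G : SimpleGraph V} {U : Set V} {p q : V} (h : Linked G U p q) :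
    Linked G U q p := by
  obtain ⟨W, hW⟩ := h
  exact ⟨W.reverse, by simpa using hW⟩

theorem Linked.trans {G : SimpleGraph V} {U : Set V} {p q s : V} (h : Linked G U p q)
    (h' : Linked G U q s) : Linked G U p s := by
  obtain ⟨W, hW⟩ := h
  obtain ⟨W', hW'⟩ := h'
  refine ⟨W.append W', fun u hu => ?_⟩
  rcases (SimpleGraph.Walk.mem_support_append_iff W W').1 hu with h | h
  · exact hW u h
  · exact hW' u h

theorem Linked.mono {G : SimpleGraph V} {U U' : Set V} {p q : V} (h : Linked G U p q)
    (hU : U ⊆ U') : Linked G U' p q := by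
  obtain ⟨W, hW⟩ := h
  exact ⟨W, fun u hu => hU (hW u hu)⟩

theorem Linked.of_adj {G : SimpleGraph V} {U : Set V} {p q : V} (hp : p ∈ U) (hq : q ∈ U)
    (h : G.Adj p q) : Linked G U p q :=
  ⟨.cons h .nil, by simp [hp, hq]⟩

theorem Linked.of_eq_or_adj {G : SimpleGraph V} {U : Set V} {p q : V} (hp : p ∈ U) (hq : q ∈ U)
    (h : p = q ∨ G.Adj p q) : Linked G U p q := by
  rcases h with rfl | h
  · exact .refl hp
  · exact .of_adj hp hq h

theorem linked_of_seq {G : SimpleGraph V} {U : Set V} {f : ℕ → V} {i j : ℕ} (hij : i ≤ j)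
    (hU : ∀ t, i ≤ t → t ≤ j → f t ∈ U) (hadj : ∀ t, i ≤ t → t < j → G.Adj (f t) (f (t + 1))) :
    Linked G U (f i) (f j) := by
  induction j, hij using Nat.le_induction with
  | base => exact .refl (hU i le_rfl le_rfl)
  | succ j hij ih =>
    refine (ih (fun t h1 h2 => hU t h1 (by omega)) (fun t h1 h2 => hadj t h1 (by omega))).trans ?_
    exact .of_adj (hU _ hij (by omega)) (hU _ (by omega) le_rfl) (hadj _ hij (by omega))

theorem linked_of_connected {G : SimpleGraph V} {C : Set V} (hC : (G.induce C).Connected) {p q : V}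
    (hp : p ∈ C) (hq : q ∈ C) : Linked G C p q := by
  obtain ⟨W⟩ := hC.preconnected ⟨p, hp⟩ ⟨q, hq⟩
  refine ⟨W.map (SimpleGraph.Embedding.induce C).toHom, fun u hu => ?_⟩
  obtain ⟨w, -, rfl⟩ := List.mem_map.1 (SimpleGraph.Walk.support_map _ W ▸ hu)
  exact w.2

/-- A vertex adjacent to exactly the two ends of an induced path closes it to a hole. -/
theorem IsPathSeq.isHoleSeq {G : SimpleGraph V} {m : ℕ} {f : ℕ → V} {x : V} (hf : IsPathSeq G m f)
    (hm : 2 ≤ m) (h0 : G.Adj x (f 0)) (h1 : G.Adj x (f m))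
    (hx : ∀ i, 0 < i → i < m → ¬ G.Adj x (f i)) (hne : ∀ i ≤ m, f i ≠ x) :
    IsHoleSeq G (m + 2) (fun i => if i = 0 then x else f (i - 1)) := by
  have hx' : ∀ i ≤ m, (G.Adj x (f i) ↔ i = 0 ∨ i = m) := by
    intro i hi
    constructor
    · intro h
      by_contra hc
      exact hx i (by omega) (by omega) h
    · rintro (rfl | rfl)
      · exact h0
      · exact h1
  refine ⟨by omega, fun i hi j hj hij => ?_, fun i hi j hj => ?_⟩
  · split_ifs at hij with hi0 hj0 hj0
    · omega
    · exact absurd hij.symm (hne _ (by omega))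
    · exact absurd hij (hne _ (by omega))
    · have := hf.inj _ (by omega) _ (by omega) hij
      omega
  · split_ifs with hi0 hj0 hj0
    · simp only [SimpleGraph.irrefl, false_iff]; omega
    · rw [hx' _ (by omega)]; omega
    · rw [G.adj_comm, hx' _ (by omega)]; omega
    · rw [hf.adj_iff _ (by omega) _ (by omega)]; omega

/-- If `x` has neighbors `p` and `q` that are linked in `U ∌ x`, and the neighbors of `x` in `U` are
split into two parts that are far from each other, then there is a hole through `x` and `U`. -/
theorem hasHoleIn_of_split {G : SimpleGraph V} {U A₁ A₂ : Set V} {x p q : V} (hxU : x ∉ U)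
    (hpq : Linked G U p q) (hxp : G.Adj x p) (hxq : G.Adj x q) (hp : p ∈ A₁) (hq : q ∈ A₂)
    (hcover : ∀ u ∈ U, G.Adj x u → u ∈ A₁ ∨ u ∈ A₂)
    (hsep : ∀ u ∈ A₁, ∀ v ∈ A₂, u ∈ U → v ∈ U → G.Adj x u → G.Adj x v → u ≠ v ∧ ¬ G.Adj u v) :
    HasHoleIn G (insert x U) := by
  classical
  -- Take a shortest walk in `U` from a neighbor of `x` in `A₁` to one in `A₂`. Minimality makes it
  -- induced (`hshort`), with no neighbor of `x` inside (`hcut`, `hdrop`), and separation makes its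
  -- length at least two; `x` then closes it to a hole.
  let Q : ℕ → Prop := fun m => ∃ f : ℕ → V, f 0 ∈ A₁ ∧ G.Adj x (f 0) ∧ f m ∈ A₂ ∧ G.Adj x (f m) ∧
    (∀ i ≤ m, f i ∈ U) ∧ ∀ i < m, G.Adj (f i) (f (i + 1))
  have hQ : ∃ m, Q m := by
    obtain ⟨W, hW⟩ := hpq
    refine ⟨W.length, W.getVert, by simpa using hp, by simpa using hxp, by simpa using hq,
      by simpa using hxq, fun i _ => hW _ (W.getVert_mem_support i),
      fun i hi => W.adj_getVert_succ hi⟩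
  obtain ⟨f, hf0, hx0, hfm, hxm, hfU, hfa⟩ := Nat.find_spec hQ
  have hmin : ∀ m, m < Nat.find hQ → ¬ Q m := fun m hm => Nat.find_min hQ hm
  set m := Nat.find hQ with hm
  clear_value m
  have hshort : ∀ i j, i + 1 < j → j ≤ m → ¬ G.Adj (f i) (f j) := by
    intro i j hij hj hadj
    refine hmin (i + 1 + (m - j)) (by omega)
      ⟨fun t => if t ≤ i then f t else f (t - (i + 1) + j), by simpa using hf0,
        by simpa using hx0, ?_, ?_, ?_, ?_⟩
    · beta_reduce
      rw [if_neg (by omega), show i + 1 + (m - j) - (i + 1) + j = m by omega]; exact hfm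
    · beta_reduce
      rw [if_neg (by omega), show i + 1 + (m - j) - (i + 1) + j = m by omega]; exact hxm
    · intro t ht
      beta_reduce
      split_ifs
      · exact hfU _ (by omega)
      · exact hfU _ (by omega)
    · intro t ht
      beta_reduce
      rcases lt_trichotomy t i with h | h | h
      · rw [if_pos h.le, if_pos (by omega)]; exact hfa t (by omega)
      · rw [if_pos h.le, if_neg (by omega), h]; simpa using hadj
      · rw [if_neg (by omega), if_neg (by omega),
          show t + 1 - (i + 1) + j = t - (i + 1) + j + 1 by omega]
        exact hfa _ (by omega)
  have hcut : ∀ i < m, ¬ (f i ∈ A₂ ∧ G.Adj x (f i)) := fun i hi h =>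
    hmin i hi ⟨f, hf0, hx0, h.1, h.2, fun t ht => hfU t (by omega), fun t ht => hfa t (by omega)⟩
  have hdrop : ∀ i, 0 < i → i ≤ m → ¬ (f i ∈ A₁ ∧ G.Adj x (f i)) := fun i hi him h =>
    hmin (m - i) (by omega) ⟨fun t => f (t + i), by simpa using h.1, by simpa using h.2,
      by simpa [Nat.sub_add_cancel him] using hfm, by simpa [Nat.sub_add_cancel him] using hxm,
      fun t ht => hfU _ (by omega), fun t ht => by
        have := hfa (t + i) (by omega)
        rwa [show t + i + 1 = t + 1 + i by omega] at this⟩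
  have h2m : 2 ≤ m := by
    obtain ⟨h1, h2⟩ := hsep _ hf0 _ hfm (hfU 0 (by omega)) (hfU m le_rfl) hx0 hxm
    by_contra hc
    obtain h | h : m = 0 ∨ m = 1 := by omega
    · subst h; exact h1 rfl
    · subst h; exact h2 (hfa 0 (by omega))
  have hinj : ∀ i j, i < j → j ≤ m → f i ≠ f j := by
    intro i j hij hj he
    rcases Nat.lt_or_ge j m with h | h
    -- A repeated vertex would give the chord from `i` to `j + 1`; at the end of the walk it would
    -- instead allow stopping at `i`.
    · exact hshort i (j + 1) (by omega) (by omega) (he ▸ hfa j h)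
    · obtain rfl : j = m := by omega
      exact hcut i hij ⟨he ▸ hfm, he ▸ hxm⟩
  have hpath : IsPathSeq G m f := by
    refine ⟨fun i hi j hj he => ?_, fun i hi j hj => ⟨fun hadj => ?_, fun h => ?_⟩⟩
    · rcases lt_trichotomy i j with h | h | h
      · exact absurd he (hinj i j h hj)
      · exact h
      · exact absurd he.symm (hinj j i h hi)
    · by_contra hc
      rcases lt_trichotomy i j with h | h | h
      · exact hshort i j (by omega) hj hadj
      · subst h; exact G.loopless.irrefl _ hadj
      · exact hshort j i (by omega) hi hadj.symm
    · rcases h with rfl | rfl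
      · exact hfa _ (by omega)
      · exact (hfa _ (by omega)).symm
  refine ⟨m + 2, _, hpath.isHoleSeq h2m hx0 hxm (fun i h0 hi hadj => ?_)
    (fun i hi he => hxU (he ▸ hfU i hi)), fun i hi => ?_⟩
  · rcases hcover _ (hfU i hi.le) hadj with h | h
    · exact hdrop i h0 hi.le ⟨h, hadj⟩
    · exact hcut i hi ⟨h, hadj⟩
  · split_ifs
    · exact Set.mem_insert _ _
    · exact Set.mem_insert_of_mem _ (hfU _ (by omega))

/-! ### Shortest holes -/

theorem add_mod_eq_ite {n i c : ℕ} (hi : i < n) (hc : c < n) :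
    (i + c) % n = if i + c < n then i + c else i + c - n := by
  split_ifs with h
  · exact Nat.mod_eq_of_lt h
  · rw [Nat.mod_eq_sub_mod (by omega), Nat.mod_eq_of_lt (by omega)]

theorem IsHoleSeq.rotate {G : SimpleGraph V} {n : ℕ} {h : ℕ → V} (hh : IsHoleSeq G n h) {c : ℕ}
    (hc : c < n) : IsHoleSeq G n (fun i => h ((i + c) % n)) := by
  have h4 := hh.four_le
  refine ⟨h4, fun i hi j hj he => ?_, fun i hi j hj => ?_⟩
  · have := hh.inj _ (Nat.mod_lt _ (by omega)) _ (Nat.mod_lt _ (by omega)) he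
    rw [add_mod_eq_ite hi hc, add_mod_eq_ite hj hc] at this
    split_ifs at this <;> omega
  · rw [hh.adj_iff _ (Nat.mod_lt _ (by omega)) _ (Nat.mod_lt _ (by omega)),
      add_mod_eq_ite hi hc, add_mod_eq_ite hj hc]
    split_ifs <;> omega

/-- The sequence `h` is a hole of `G` of minimum length. -/
structure IsShortestHoleSeq (G : SimpleGraph V) (n : ℕ) (h : ℕ → V) : Prop where
  isHoleSeq : IsHoleSeq G n h
  le : ∀ n' g, IsHoleSeq G n' g → n ≤ n'

/-- Otherwise the neighbors of `y` nearest to `h t` on its two sides bound an arc that `y` closes to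
a hole. It has at most `d + 2 < n` vertices, contradicting minimality. -/
theorem IsShortestHoleSeq.not_adj_of_not_adj_between {G : SimpleGraph V} {n : ℕ} {h : ℕ → V}
    (hh : IsShortestHoleSeq G n h) {y : V} (hy : ∀ i < n, y ≠ h i) {d t : ℕ} (hd : d + 3 ≤ n)
    (htd : t < d) (h0 : G.Adj y (h 0)) (ht : ¬ G.Adj y (h t)) : ¬ G.Adj y (h d) := by
  classical
  intro hyd
  have hex : ∃ u, t < u ∧ G.Adj y (h u) := ⟨d, htd, hyd⟩
  obtain ⟨u, ⟨hu, hyu⟩, humin⟩ : ∃ u, (t < u ∧ G.Adj y (h u)) ∧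
      ∀ w < u, ¬ (t < w ∧ G.Adj y (h w)) :=
    ⟨Nat.find hex, Nat.find_spec hex, fun w hw => Nat.find_min hex hw⟩
  have hud : u ≤ d := by
    by_contra hc
    exact humin d (by omega) ⟨htd, hyd⟩
  -- The last neighbor of `y` at or before `t` is found by minimizing the distance `e` back from
  -- `t`.
  have hex' : ∃ e, e ≤ t ∧ G.Adj y (h (t - e)) := ⟨t, le_rfl, by simpa using h0⟩
  obtain ⟨e, ⟨he, hye⟩, hemin⟩ : ∃ e, (e ≤ t ∧ G.Adj y (h (t - e))) ∧
      ∀ w < e, ¬ (w ≤ t ∧ G.Adj y (h (t - w))) :=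
    ⟨Nat.find hex', Nat.find_spec hex', fun w hw => Nat.find_min hex' hw⟩
  have he0 : e ≠ 0 := by
    rintro rfl
    exact ht (by simpa using hye)
  have hadj := hh.isHoleSeq.adj_iff
  have hpath : IsPathSeq G (u - (t - e)) (fun i => h (t - e + i)) := by
    refine ⟨fun i hi j hj hij => ?_, fun i hi j hj => ?_⟩
    · have := hh.isHoleSeq.inj _ (by omega) _ (by omega) hij
      omega
    · rw [hadj _ (by omega) _ (by omega)]; omega
  have := hh.le _ _ (hpath.isHoleSeq (x := y) (by omega) (by simpa using hye)
    (by rw [show t - e + (u - (t - e)) = u by omega]; exact hyu) (fun i hi0 hi => ?_)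
    (fun i hi => (hy _ (by omega)).symm))
  · omega
  · intro hyi
    rcases Nat.lt_or_ge t (t - e + i) with h1 | h1
    · exact humin _ (by omega) ⟨h1, hyi⟩
    · refine hemin (t - (t - e + i)) (by omega) ⟨by omega, ?_⟩
      rwa [show t - (t - (t - e + i)) = t - e + i by omega]

theorem IsShortestHoleSeq.rotate {G : SimpleGraph V} {n : ℕ} {h : ℕ → V}
    (hh : IsShortestHoleSeq G n h) {c : ℕ} (hc : c < n) :
    IsShortestHoleSeq G n (fun i => h ((i + c) % n)) :=
  ⟨hh.isHoleSeq.rotate hc, hh.le⟩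

/-- A vertex that is not adjacent to all of a shortest hole has no two neighbors on it that
are at distance at least three. -/
theorem IsShortestHoleSeq.sub_le_two {G : SimpleGraph V} {n : ℕ} {h : ℕ → V}
    (hh : IsShortestHoleSeq G n h) {y : V} (hy : ∃ t < n, ¬ G.Adj y (h t)) {i j : ℕ}
    (hi : 3 ≤ i) (hij : i ≤ j) (hj : j < n) (hyi : h i = y ∨ G.Adj y (h i))
    (hyj : h j = y ∨ G.Adj y (h j)) : j ≤ i + 2 := by
  by_cases hyh : ∃ t < n, y = h t
  · obtain ⟨t, ht, rfl⟩ := hyh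
    have hadj := hh.isHoleSeq.adj_iff
    have hinj := hh.isHoleSeq.inj
    have h1 : i = t ∨ (t + 1 = i ∨ i + 1 = t ∨ (t = 0 ∧ i + 1 = n) ∨ (i = 0 ∧ t + 1 = n)) :=
      hyi.imp (hinj _ (by omega) _ ht) (hadj _ ht _ (by omega)).1
    have h2 : j = t ∨ (t + 1 = j ∨ j + 1 = t ∨ (t = 0 ∧ j + 1 = n) ∨ (j = 0 ∧ t + 1 = n)) :=
      hyj.imp (hinj _ (by omega) _ ht) (hadj _ ht _ (by omega)).1
    omega
  · push Not at hyh
    replace hyi : G.Adj y (h i) := hyi.resolve_left (hyh i (by omega)).symm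
    replace hyj : G.Adj y (h j) := hyj.resolve_left (hyh j (by omega)).symm
    by_contra hc
    obtain ⟨t, ht, hyt⟩ := hy
    have hti : t ≠ i := by rintro rfl; exact hyt hyi
    have htj : t ≠ j := by rintro rfl; exact hyt hyj
    -- The non-neighbor `h t` lies on one of the two arcs between `h i` and `h j`; rotate so that
    -- this arc starts at index 0. Both arcs are short enough: `3 ≤ i` bounds the inner one and `i +
    -- 3 ≤ j` the outer one.
    by_cases hcase : i < t ∧ t < j
    · have := (hh.rotate (c := i) (by omega)).not_adj_of_not_adj_between (y := y) (d := j - i)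
        (t := t - i) (fun e he => hyh _ (Nat.mod_lt _ (by omega))) (by omega) (by omega)
      simp only [zero_add, Nat.sub_add_cancel hij, Nat.sub_add_cancel hcase.1.le,
        Nat.mod_eq_of_lt hj, Nat.mod_eq_of_lt ht, Nat.mod_eq_of_lt (show i < n by omega)] at this
      exact this hyi hyt hyj
    · obtain ⟨t', ht', htt⟩ : ∃ t', t' < n + i - j ∧ (t' + j) % n = t := by
        rcases Nat.lt_or_ge t i with h1 | h1
        · refine ⟨n + t - j, by omega, ?_⟩
          rw [show n + t - j + j = t + n by omega, Nat.add_mod_right, Nat.mod_eq_of_lt ht]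
        · exact ⟨t - j, by omega, by
            rw [show t - j + j = t by omega, Nat.mod_eq_of_lt ht]⟩
      have := (hh.rotate (c := j) (by omega)).not_adj_of_not_adj_between (y := y) (d := n + i - j)
        (t := t') (fun e he => hyh _ (Nat.mod_lt _ (by omega))) (by omega) (by omega)
      simp only [zero_add, htt, Nat.mod_eq_of_lt hj,
        show n + i - j + j = i + n by omega, Nat.add_mod_right,
        Nat.mod_eq_of_lt (show i < n by omega)] at this
      exact this hyj hyt hyi

theorem isHoleSeq_four {G : SimpleGraph V} {a b c d : V} (hab : G.Adj a b) (hbc : G.Adj b c)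
    (hcd : G.Adj c d) (hda : G.Adj d a) (hac : ¬ G.Adj a c) (hbd : ¬ G.Adj b d)
    (hac' : a ≠ c) (hbd' : b ≠ d) :
    IsHoleSeq G 4 (fun i => if i = 0 then a else if i = 1 then b else if i = 2 then c else d) := by
  refine ⟨le_rfl, fun i hi j hj => ?_, fun i hi j hj => ?_⟩
  · interval_cases i <;> interval_cases j <;>
      simp [hac', hbd', hac'.symm, hbd'.symm, hab.ne, hbc.ne, hcd.ne, hda.ne, hab.ne', hbc.ne',
        hcd.ne', hda.ne']
  · interval_cases i <;> interval_cases j <;>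
      simp [hab, hbc, hcd, hda, hac, hbd, hab.symm, hbc.symm, hcd.symm, hda.symm, mt SimpleGraph.Adj.symm hac,
        mt SimpleGraph.Adj.symm hbd]

/-- The common neighbors of a shortest hole of length at least five form a clique. -/
theorem IsShortestHoleSeq.adj_of_common {G : SimpleGraph V} {n : ℕ} {h : ℕ → V}
    (hh : IsShortestHoleSeq G n h) (hn : 5 ≤ n) {a a' : V} (ha : ∀ i < n, G.Adj a (h i))
    (ha' : ∀ i < n, G.Adj a' (h i)) (hne : a ≠ a') : G.Adj a a' := by
  by_contra hadj
  have h02 : ¬ G.Adj (h 0) (h 2) := by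
    rw [hh.isHoleSeq.adj_iff _ (by omega) _ (by omega)]; omega
  have h02' : h 0 ≠ h 2 := fun e => by
    have := hh.isHoleSeq.inj _ (by omega) _ (by omega) e
    omega
  have := hh.le _ _ (isHoleSeq_four (ha 0 (by omega)) (ha' 0 (by omega)).symm (ha' 2 (by omega))
    (ha 2 (by omega)).symm hadj h02 hne h02')
  omega

/-! ### Editing sets and families of almost disjoint holes -/

/-- An editing set has at least as many elements as there are holes in a family whose members
meet pairwise only in a set `Z`, if the edits do not concern the parts in `Z`. -/
theorem IsChordalEditingSet.card_le {G : SimpleGraph V} {Vd : Finset V} {Ed Ea : Finset (Sym2 V)}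
    (hsol : IsChordalEditingSet G Vd Ed Ea) {ι : Type*} (I : Finset ι) (F : ι → Set V) (Z : Set V)
    (hF : ∀ i ∈ I, HasHoleIn G (F i))
    (hdisj : ∀ i ∈ I, ∀ j ∈ I, i ≠ j → ∀ v ∈ F i, v ∈ F j → v ∈ Z)
    (hV : ∀ i ∈ I, ∀ v ∈ F i, v ∈ Z → v ∉ Vd)
    (hEd : ∀ i ∈ I, ∀ u ∈ F i, ∀ v ∈ F i, u ∈ Z → v ∈ Z → s(u, v) ∉ Ed)
    (hEa : ∀ i ∈ I, ∀ u ∈ F i, ∀ v ∈ F i, u ∈ Z → v ∈ Z → s(u, v) ∉ Ea) :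
    I.card ≤ Vd.card + Ed.card + Ea.card := by
  classical
  -- An edit touches a member when all its vertices lie there. Each member is touched, since an
  -- untouched hole survives, and an edit touching two members would lie in `Z`.
  let R : V ⊕ Sym2 V ⊕ Sym2 V → ι → Prop := fun t i =>
    Sum.elim (fun v => v ∈ F i) (Sum.elim (fun e => ∀ v ∈ e, v ∈ F i) (fun e => ∀ v ∈ e, v ∈ F i)) t
  let E : Finset (V ⊕ Sym2 V ⊕ Sym2 V) := Vd.disjSum (Ed.disjSum Ea)
  have htouch : ∀ i ∈ I, ∃ t ∈ E, R t i := by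
    intro i hi
    by_contra hc
    push Not at hc
    have hc1 : ∀ v ∈ Vd, v ∉ F i := fun v hv => hc (.inl v) (by simpa [E] using hv)
    have hc2 : ∀ e ∈ Ed, ¬ ∀ v ∈ e, v ∈ F i := fun e he => hc (.inr (.inl e)) (by simpa [E] using he)
    have hc3 : ∀ e ∈ Ea, ¬ ∀ v ∈ e, v ∈ F i := fun e he => hc (.inr (.inr e)) (by simpa [E] using he)
    obtain ⟨n, g, hg, hgF⟩ := hF i hi
    refine isChordal_induce_iff.1 hsol.2.2 ⟨n, g, hg.of_comap (fun _ _ _ _ e => e)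
      (fun a ha b hb => ?_), fun a ha => fun hd => hc1 _ hd (hgF a ha)⟩
    have h2 : s(g a, g b) ∉ Ed := fun he => hc2 _ he (by simp [hgF a ha, hgF b hb])
    have h3 : s(g a, g b) ∉ Ea := fun he => hc3 _ he (by simp [hgF a ha, hgF b hb])
    simp [SimpleGraph.sup_adj, SimpleGraph.deleteEdges_adj, h2, h3]
  have hcard : E.card = Vd.card + Ed.card + Ea.card := by
    simp [E, Finset.card_disjSum, add_assoc]
  rw [← hcard]
  refine Finset.card_le_card_of_forall_subsingleton (fun i t => R t i) htouch ?_
  rintro e h3 i ⟨hi, h1⟩ j ⟨hj, h2⟩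
  by_contra hne
  rcases e with v | e | e
  · exact hV i hi v h1 (hdisj i hi j hj hne v h1 h2) (by simpa [E] using h3)
  · induction e with
    | h u v =>
      simp only [R, Sum.elim_inr, Sum.elim_inl, Sym2.mem_iff, forall_eq_or_imp, forall_eq] at h1 h2
      exact hEd i hi u h1.1 v h1.2 (hdisj i hi j hj hne u h1.1 h2.1)
        (hdisj i hi j hj hne v h1.2 h2.2) (by simpa [E] using h3)
  · induction e with
    | h u v =>
      simp only [R, Sum.elim_inr, Sym2.mem_iff, forall_eq_or_imp, forall_eq] at h1 h2
      exact hEa i hi u h1.1 v h1.2 (hdisj i hi j hj hne u h1.1 h2.1)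
        (hdisj i hi j hj hne v h1.2 h2.2) (by simpa [E] using h3)

/-! ### Local structure along a path of a shortest hole -/

/-- The vertices adjacent to all of `h 0, …, h (n - 1)`. -/
def commonSeq (G : SimpleGraph V) (n : ℕ) (h : ℕ → V) : Set V :=
  {a | ∀ i < n, G.Adj a (h i)}

/-- The vertices outside of `M` that are not adjacent to all of `h 0, …, h (n - 1)`. -/
def restSet (G : SimpleGraph V) (M : Finset V) (n : ℕ) (h : ℕ → V) : Set V :=
  {v | v ∉ M ∧ v ∉ commonSeq G n h}

/-- A shortest hole `h` of length at least five, a hole cover `M`, and a subpath `h l, …, h r` of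
the hole that avoids `M`. -/
structure HoleSetting (G : SimpleGraph V) (M : Finset V) (n : ℕ) (h : ℕ → V) (l r : ℕ) : Prop where
  shortest : IsShortestHoleSeq G n h
  five_le : 5 ≤ n
  not_hasHoleIn : ¬ HasHoleIn G {v | v ∉ M}
  lt : r < n
  one_le : 1 ≤ l
  notMem : ∀ i, l ≤ i → i ≤ r → h i ∉ M

/-- `C` is a connected subset of `S ∖ U` whose neighborhood in `S` is a nonempty clique contained
in `U` and in the closed neighborhood of `v`. -/
structure IsNearSet (G : SimpleGraph V) (S U : Set V) (v : V) (C : Set V) : Prop where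
  subset : C ⊆ S
  notMem : ∀ c ∈ C, c ∉ U
  linked : ∀ u ∈ C, ∀ w ∈ C, Linked G C u w
  nbhd_subset : nbhd G C ∩ S ⊆ U
  isClique : G.IsClique (nbhd G C ∩ S)
  eq_or_adj : ∀ y ∈ nbhd G C ∩ S, v = y ∨ G.Adj y v
  nonempty : (nbhd G C ∩ S).Nonempty

theorem Linked.mem_of_closed {G : SimpleGraph V} {U C : Set V} {p q : V} (hpq : Linked G U p q)
    (hp : p ∈ C) (hC : ∀ a ∈ C, ∀ b ∈ U, G.Adj a b → b ∈ C) : q ∈ C := by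
  obtain ⟨W, hW⟩ := hpq
  induction W with
  | nil => exact hp
  | cons hadj W ih =>
    refine ih (hC _ hp _ (hW _ ?_) hadj) (fun u hu => hW u ?_)
    · simp
    · simp [hu]

namespace HoleSetting

variable {G : SimpleGraph V} {M : Finset V} {n : ℕ} {h : ℕ → V} {l r : ℕ}

theorem mem_restSet (hs : HoleSetting G M n h l r) {i : ℕ} (hl : l ≤ i) (hr : i ≤ r) :
    h i ∈ restSet G M n h :=
  ⟨hs.notMem i hl hr, fun hc => G.loopless.irrefl _ (hc i (lt_of_le_of_lt hr hs.lt))⟩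

theorem adj_iff (hs : HoleSetting G M n h l r) {i j : ℕ} (hi : l ≤ i) (hi' : i ≤ r) (hj : l ≤ j)
    (hj' : j ≤ r) : G.Adj (h i) (h j) ↔ i + 1 = j ∨ j + 1 = i := by
  have := hs.lt
  have := hs.one_le
  rw [hs.shortest.isHoleSeq.adj_iff i (by omega) j (by omega)]
  omega

theorem eq_iff (hs : HoleSetting G M n h l r) {i j : ℕ} (hi' : i ≤ r)
    (hj' : j ≤ r) : h i = h j ↔ i = j := by
  have := hs.lt
  exact ⟨fun e => hs.shortest.isHoleSeq.inj i (by omega) j (by omega) e, fun e => by rw [e]⟩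

/-- The bound `3` on the indices excludes wrap-around: two of them at least three apart are also at
least three apart the other way round the hole. -/
theorem index_le (hs : HoleSetting G M n h l r) {y : V} (hy : y ∉ commonSeq G n h) {i j : ℕ}
    (hi : 3 ≤ i) (hin : i < n) (hj : 3 ≤ j) (hjn : j < n) (hyi : h i = y ∨ G.Adj y (h i))
    (hyj : h j = y ∨ G.Adj y (h j)) : j ≤ i + 2 ∧ i ≤ j + 2 := by
  have hy' : ∃ t < n, ¬ G.Adj y (h t) := by
    simpa [commonSeq] using hy
  rcases le_total i j with hij | hij
  · have := hs.shortest.sub_le_two hy' hi hij hjn hyi hyj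
    omega
  · have := hs.shortest.sub_le_two hy' hj hij hin hyj hyi
    omega

theorem linked_seq (hs : HoleSetting G M n h l r) {U : Set V} {i j : ℕ} (hl : l ≤ i) (hij : i ≤ j)
    (hr : j ≤ r) (hU : ∀ t, i ≤ t → t ≤ j → h t ∈ U) : Linked G U (h i) (h j) :=
  linked_of_seq hij hU fun t h1 h2 => (hs.adj_iff (by omega) (by omega) (by omega) (by omega)).2
    (Or.inl rfl)

theorem mem_V2 (hs : HoleSetting G M n h l r) {i : ℕ} (hl : l ≤ i) (hr : i ≤ r) :
    h i ∈ V2 G (restSet G M n h) (h l) (h r) := by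
  have hp : IsPathSeq G (r - l) (fun i => h (l + i)) := by
    refine ⟨fun i hi j hj e => ?_, fun i hi j hj => ?_⟩
    · have := (hs.eq_iff (by omega) (by omega)).1 e
      omega
    · rw [hs.adj_iff (by omega) (by omega) (by omega) (by omega)]; omega
  obtain ⟨W, h1, h2, h3⟩ := hp.exists_walk (u := h l) (v := h r) rfl
    (by rw [show l + (r - l) = r by omega])
  refine ⟨W, h1, h2, fun u hu => ?_, (h3 _).2 ⟨i - l, by omega, by
    rw [show l + (i - l) = i by omega]⟩⟩
  obtain ⟨i, hi, rfl⟩ := (h3 u).1 hu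
  exact hs.mem_restSet (by omega) (by omega)

theorem not_hasHoleIn_restSet (hs : HoleSetting G M n h l r) {U : Set V}
    (hU : U ⊆ restSet G M n h) : ¬ HasHoleIn G U :=
  fun hole => hs.not_hasHoleIn (hole.mono fun _ hu => (hU hu).1)

/-- An inner vertex of the path dominates every connected set outside `M` and `A` that
touches both sides of the path. -/
theorem exists_eq_or_adj (hs : HoleSetting G M n h l r) {Z : Set V} (hZ : Z ⊆ restSet G M n h)
    {p q : V} (hpq : Linked G Z p q) {u c w : ℕ} (hlu : l ≤ u) (huc : u < c) (hcw : c < w)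
    (hwr : w ≤ r) (hp : h u = p ∨ G.Adj p (h u)) (hq : h w = q ∨ G.Adj q (h w)) :
    ∃ z ∈ Z, h c = z ∨ G.Adj z (h c) := by
  by_contra hc
  push Not at hc
  have hpZ : p ∈ Z := by
    obtain ⟨W, hW⟩ := hpq
    exact hW _ W.start_mem_support
  have hqZ : q ∈ Z := by
    obtain ⟨W, hW⟩ := hpq
    exact hW _ W.end_mem_support
  let U : Set V := Z ∪ {x | ∃ t, u ≤ t ∧ t ≤ w ∧ t ≠ c ∧ x = h t}
  have hUt : ∀ t, u ≤ t → t ≤ w → t ≠ c → h t ∈ U := fun t h1 h2 h3 =>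
    Or.inr ⟨t, h1, h2, h3, rfl⟩
  -- If `Z` avoided the closed neighborhood of `h c`, the two path neighbors of `h c` would be
  -- linked through `Z` and the rest of the path, which gives a hole in `V₀`.
  have hlink : Linked G U (h (c - 1)) (h (c + 1)) := by
    have e1 : Linked G U (h u) (h (c - 1)) := hs.linked_seq hlu (by omega) (by omega)
      (fun t h1 h2 => hUt t h1 (by omega) (by omega))
    have e2 : Linked G U (h (c + 1)) (h w) := hs.linked_seq (by omega) (by omega) (by omega)
      (fun t h1 h2 => hUt t (by omega) h2 (by omega))
    have e3 : Linked G U (h u) p := .of_eq_or_adj (hUt u le_rfl (by omega) (by omega))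
      (Or.inl hpZ) (hp.imp_right fun e => e.symm)
    have e4 : Linked G U (h w) q := .of_eq_or_adj (hUt w (by omega) (by omega) (by omega))
      (Or.inl hqZ) (hq.imp_right fun e => e.symm)
    exact ((e1.symm.trans e3).trans (hpq.mono fun _ hx => Or.inl hx)).trans (e4.symm.trans e2.symm)
  have hole := hasHoleIn_of_split (x := h c) (U := U) (A₁ := {h (c - 1)}) (A₂ := {h (c + 1)}) ?_
    hlink ((hs.adj_iff (by omega) (by omega) (by omega) (by omega)).2 (by omega))
    ((hs.adj_iff (by omega) (by omega) (by omega) (by omega)).2 (by omega)) rfl rfl ?_ ?_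
  · refine hs.not_hasHoleIn_restSet ?_ hole
    rintro x (rfl | hx | ⟨t, h1, h2, -, rfl⟩)
    · exact hs.mem_restSet (by omega) (by omega)
    · exact hZ hx
    · exact hs.mem_restSet (by omega) (by omega)
  · rintro (hx | ⟨t, h1, h2, h3, h4⟩)
    · exact (hc _ hx).1 rfl
    · exact h3 ((hs.eq_iff (by omega) (by omega)).1 h4).symm
  · rintro x (hx | ⟨t, h1, h2, h3, rfl⟩) hadj
    · exact absurd hadj.symm (hc _ hx).2
    · rcases (hs.adj_iff (by omega) (by omega) (by omega) (by omega)).1 hadj with h4 | h4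
      · right; rw [← h4]; rfl
      · left; rw [show t = c - 1 by omega]; rfl
  · rintro x hx y hy - - - -
    obtain rfl := Set.mem_singleton_iff.1 hx
    obtain rfl := Set.mem_singleton_iff.1 hy
    refine ⟨fun e => ?_, fun e => ?_⟩
    · have := (hs.eq_iff (by omega) (by omega)).1 e
      omega
    · have := (hs.adj_iff (by omega) (by omega) (by omega) (by omega)).1 e
      omega

/-! ### Pods: connected sets attached to one vertex of the path -/

/-- A connected set attached to the vertex `h i` of the path. -/
structure IsPod (G : SimpleGraph V) (M : Finset V) (n : ℕ) (h : ℕ → V) (l r i : ℕ) (X : Set V) :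
    Prop where
  subset : X ⊆ restSet G M n h
  linked : ∀ u ∈ X, Linked G X u (h i)
  index_le : ∀ w ∈ X, ∀ j, 3 ≤ j → l ≤ j → j ≤ r → (h j = w ∨ G.Adj w (h j)) →
    j ≤ i + 2 ∧ i ≤ j + 2
  cases : ∀ w ∈ X, (h i = w ∨ G.Adj w (h i)) ∨
    ∃ C, IsNearSet G (restSet G M n h) (V2 G (restSet G M n h) (h l) (h r)) (h i) C ∧ w ∈ C

theorem isPod_pair (hs : HoleSetting G M n h l r) {i : ℕ} (hi : 3 ≤ i) (hl : l ≤ i) (hr : i ≤ r)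
    {y : V} (hy : y ∈ restSet G M n h) (hyi : h i = y ∨ G.Adj y (h i)) :
    IsPod G M n h l r i {h i, y} := by
  have := hs.lt
  have hcl : ∀ w ∈ ({h i, y} : Set V), w ∈ restSet G M n h ∧ (h i = w ∨ G.Adj w (h i)) := by
    rintro w (rfl | rfl)
    · exact ⟨hs.mem_restSet hl hr, Or.inl rfl⟩
    · exact ⟨hy, hyi⟩
  refine ⟨fun w hw => (hcl w hw).1, fun w hw => ?_, fun w hw j hj hlj hjr hwj => ?_,
    fun w hw => Or.inl (hcl w hw).2⟩
  · exact .of_eq_or_adj hw (by simp) ((hcl w hw).2.imp_left Eq.symm)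
  · exact hs.index_le (hcl w hw).1.2 hi (by omega) hj (by omega) (hcl w hw).2 hwj

/-- A path vertex `h j` lies in `V₂`, hence outside `C`. If it is adjacent to `C`, it belongs to
`N(C) ∩ V₀`, whose vertices are all in the closed neighborhood of `h i`; so `j` is close to `i`. -/
theorem isPod_nearSet (hs : HoleSetting G M n h l r) {i : ℕ} (hi : 3 ≤ i) (hl : l ≤ i)
    (hr : i ≤ r) {C : Set V}
    (hC : IsNearSet G (restSet G M n h) (V2 G (restSet G M n h) (h l) (h r)) (h i) C) :
    IsPod G M n h l r i (insert (h i) (C ∪ nbhd G C ∩ restSet G M n h)) := by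
  have := hs.lt
  have hcl : ∀ w ∈ (insert (h i) (nbhd G C ∩ restSet G M n h) : Set V),
      w ∈ restSet G M n h ∧ (h i = w ∨ G.Adj w (h i)) := by
    rintro w (rfl | hw)
    · exact ⟨hs.mem_restSet hl hr, Or.inl rfl⟩
    · exact ⟨hw.2, hC.eq_or_adj w hw⟩
  have hsplit : ∀ w ∈ (insert (h i) (C ∪ nbhd G C ∩ restSet G M n h) : Set V),
      w ∈ C ∨ w ∈ (insert (h i) (nbhd G C ∩ restSet G M n h) : Set V) := by
    rintro w (rfl | hw | hw)
    · exact Or.inr (Or.inl rfl)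
    · exact Or.inl hw
    · exact Or.inr (Or.inr hw)
  refine ⟨fun w hw => ?_, fun w hw => ?_, fun w hw j hj hlj hjr hwj => ?_, fun w hw => ?_⟩
  · rcases hsplit w hw with h1 | h1
    · exact hC.subset h1
    · exact (hcl w h1).1
  · rcases hsplit w hw with h1 | h1
    · obtain ⟨y, hy⟩ := hC.nonempty
      obtain ⟨c, hc, hcy⟩ := hy.1.2
      have e1 : Linked G (insert (h i) (C ∪ nbhd G C ∩ restSet G M n h)) w c :=
        (hC.linked w h1 c hc).mono fun x hx => Or.inr (Or.inl hx)
      have e2 : Linked G (insert (h i) (C ∪ nbhd G C ∩ restSet G M n h)) c y :=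
        .of_adj (Or.inr (Or.inl hc)) (Or.inr (Or.inr hy)) hcy
      exact (e1.trans e2).trans (.of_eq_or_adj (Or.inr (Or.inr hy)) (Or.inl rfl)
        ((hC.eq_or_adj y hy).imp_left Eq.symm))
    · exact .of_eq_or_adj hw (Or.inl rfl) ((hcl w h1).2.imp_left Eq.symm)
  · rcases hsplit w hw with h1 | h1
    · have hne : h j ∉ C := fun hjC => hC.notMem _ hjC (hs.mem_V2 hlj hjr)
      have hjn : h j ∈ nbhd G C ∩ restSet G M n h := by
        refine ⟨⟨hne, w, h1, ?_⟩, hs.mem_restSet hlj hjr⟩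
        rcases hwj with h2 | h2
        · exact absurd (h2 ▸ h1) hne
        · exact h2
      exact hs.index_le (hs.mem_restSet hlj hjr).2 hi (by omega) hj (by omega)
        (hC.eq_or_adj _ hjn) (Or.inl rfl)
    · exact hs.index_le (hcl w h1).1.2 hi (by omega) hj (by omega) (hcl w h1).2 hwj
  · rcases hsplit w hw with h1 | h1
    · exact Or.inr ⟨C, hC, h1⟩
    · exact Or.inl (hcl w h1).2

/-- Near sets have no neighbors in `S ∖ U` outside themselves, so two that meet coincide. A vertex
of their common, nonempty neighborhood would then be close to both `h i` and `h j`. -/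
theorem nearSet_disjoint (hs : HoleSetting G M n h l r) {i j : ℕ} (hi : 3 ≤ i) (hin : i < n)
    (hij : i + 3 ≤ j) (hj : j < n) {C C' : Set V} {U : Set V}
    (hC : IsNearSet G (restSet G M n h) U (h i) C)
    (hC' : IsNearSet G (restSet G M n h) U (h j) C') {c : V} (hc : c ∈ C) : c ∉ C' := by
  intro hc'
  have key : ∀ {v v' : V} {D D' : Set V}, IsNearSet G (restSet G M n h) U v D →
      IsNearSet G (restSet G M n h) U v' D' → c ∈ D → c ∈ D' → D' ⊆ D := by
    intro v v' D D' hD hD' h1 h2 w hw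
    refine (hD'.linked c h2 w hw).mem_of_closed h1 (fun a ha b hb hab => ?_)
    by_contra hbD
    exact hD'.notMem b hb (hD.nbhd_subset ⟨⟨hbD, a, ha, hab⟩, hD'.subset hb⟩)
  obtain rfl : C = C' := (key hC' hC hc' hc).antisymm (key hC hC' hc hc')
  obtain ⟨y, hy⟩ := hC.nonempty
  have := hs.index_le hy.2.2 hi (by omega) (by omega) hj (hC.eq_or_adj y hy) (hC'.eq_or_adj y hy)
  omega

theorem IsPod.disjoint (hs : HoleSetting G M n h l r) {i j : ℕ} (hi : 3 ≤ i) (hl : l ≤ i)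
    (hij : i + 3 ≤ j) (hr : j ≤ r) {X Y : Set V} (hX : IsPod G M n h l r i X)
    (hY : IsPod G M n h l r j Y) {w : V} (hwX : w ∈ X) : w ∉ Y := by
  intro hwY
  have := hs.lt
  rcases hX.cases w hwX with h1 | ⟨C, hC, hwC⟩
  · have := hY.index_le w hwY i hi hl (by omega) h1
    omega
  · rcases hY.cases w hwY with h1 | ⟨C', hC', hwC'⟩
    · have := hX.index_le w hwX j (by omega) (by omega) hr h1
      omega
    · exact hs.nearSet_disjoint hi (by omega) hij (by omega) hC hC' hwC hwC'

/-- Touching pods would together connect `h i` to `h j` and so dominate `h (i + 3)`. Pods reach only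
two indices away from their centers, so distance six leaves this vertex out of reach of both. -/
theorem IsPod.far (hs : HoleSetting G M n h l r) {i j : ℕ} (hi : 3 ≤ i) (hl : l ≤ i)
    (hij : i + 6 ≤ j) (hr : j ≤ r) {X Y : Set V} (hX : IsPod G M n h l r i X)
    (hY : IsPod G M n h l r j Y) {u w : V} (hu : u ∈ X) (hw : w ∈ Y) : u ≠ w ∧ ¬ G.Adj u w := by
  have key : ¬ (u = w ∨ G.Adj u w) := by
    intro huw
    have hlink : Linked G (X ∪ Y) (h i) (h j) :=
      (((hX.linked u hu).mono Set.subset_union_left).symm.trans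
        (.of_eq_or_adj (Or.inl hu) (Or.inr hw) huw)).trans
        ((hY.linked w hw).mono Set.subset_union_right)
    obtain ⟨z, hz, hz'⟩ := hs.exists_eq_or_adj (Set.union_subset hX.subset hY.subset) hlink
      (u := i) (c := i + 3) (w := j) hl (by omega) (by omega) hr (Or.inl rfl) (Or.inl rfl)
    rcases hz with hz | hz
    · have := hX.index_le z hz (i + 3) (by omega) (by omega) (by omega) hz'
      omega
    · have := hY.index_le z hz (i + 3) (by omega) (by omega) (by omega) hz'
      omega
  exact ⟨fun e => key (Or.inl e), fun e => key (Or.inr e)⟩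

/-- The hole made of a vertex `x` adjacent to two pods that are far apart. -/
theorem IsPod.hasHoleIn (hs : HoleSetting G M n h l r) {i j : ℕ} (hi : 3 ≤ i) (hl : l ≤ i)
    (hij : i + 6 ≤ j) (hr : j ≤ r) {X Y : Set V} (hX : IsPod G M n h l r i X)
    (hY : IsPod G M n h l r j Y) {x u w : V} (hx : x ∈ M) (hu : u ∈ X) (hw : w ∈ Y)
    (hxu : G.Adj x u) (hxw : G.Adj x w) (hxh : ∀ t, i ≤ t → t ≤ j → ¬ G.Adj x (h t)) :
    HasHoleIn G (insert x (X ∪ Y ∪ {v | ∃ t, i ≤ t ∧ t ≤ j ∧ v = h t})) := by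
  have hlink : Linked G (X ∪ Y ∪ {v | ∃ t, i ≤ t ∧ t ≤ j ∧ v = h t}) u w :=
    (((hX.linked u hu).mono fun _ h1 => Or.inl (Or.inl h1)).trans
      (hs.linked_seq hl (by omega) hr fun t h1 h2 => Or.inr ⟨t, h1, h2, rfl⟩)).trans
      ((hY.linked w hw).mono fun _ h1 => Or.inl (Or.inr h1)).symm
  refine hasHoleIn_of_split (A₁ := X) (A₂ := Y) ?_ hlink hxu hxw hu hw ?_ ?_
  · rintro ((h1 | h1) | ⟨t, h1, h2, rfl⟩)
    · exact (hX.subset h1).1 hx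
    · exact (hY.subset h1).1 hx
    · exact hs.notMem t (by omega) (by omega) hx
  · rintro v (h1 | ⟨t, h1, h2, rfl⟩) hv
    · exact h1
    · exact absurd hv (hxh t h1 h2)
  · intro a ha b hb _ _ _ _
    exact hX.far hs hi hl hij hr hY ha hb

/-! ### Detours of the path that avoid a common neighbor -/

/-- If `f g` had no close vertex on the stretch `h u, …, h w`, its two neighbors on `f` would be
linked by the rest of `f` and this stretch, outside its remaining closed neighborhood, giving a hole
in `V₀`. -/
theorem detour_index (hs : HoleSetting G M n h l r) {f : ℕ → V} {m : ℕ} (hf : IsPathSeq G m f)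
    (hfS : ∀ t ≤ m, f t ∈ restSet G M n h) {u w s t g : ℕ} (hlu : l ≤ u) (huw : u ≤ w)
    (hwr : w ≤ r) (hs' : h u = f s ∨ G.Adj (f s) (h u)) (ht' : h w = f t ∨ G.Adj (f t) (h w))
    (hsg : s ≤ g) (hgt : g ≤ t) (htm : t ≤ m) :
    ∃ c, u ≤ c ∧ c ≤ w ∧ (h c = f g ∨ G.Adj (f g) (h c)) := by
  by_contra hc
  push Not at hc
  have hsg' : s < g := by
    rcases hsg.lt_or_eq with h1 | rfl
    · exact h1
    · exact absurd hs' (by simpa using hc u le_rfl huw)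
  have hgt' : g < t := by
    rcases hgt.lt_or_eq with h1 | rfl
    · exact h1
    · exact absurd ht' (by simpa using hc w huw le_rfl)
  let U : Set V := {x | ∃ e, s ≤ e ∧ e ≤ t ∧ e ≠ g ∧ x = f e} ∪ {x | ∃ e, u ≤ e ∧ e ≤ w ∧ x = h e}
  have hUf : ∀ e, s ≤ e → e ≤ t → e ≠ g → f e ∈ U := fun e h1 h2 h3 => Or.inl ⟨e, h1, h2, h3, rfl⟩
  have hUh : ∀ e, u ≤ e → e ≤ w → h e ∈ U := fun e h1 h2 => Or.inr ⟨e, h1, h2, rfl⟩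
  have hfadj : ∀ e < m, G.Adj (f e) (f (e + 1)) := fun e he =>
    (hf.adj_iff e (by omega) (e + 1) (by omega)).2 (Or.inl rfl)
  have hlink : Linked G U (f (g - 1)) (f (g + 1)) := by
    have e1 : Linked G U (f s) (f (g - 1)) := linked_of_seq (by omega)
      (fun e h1 h2 => hUf e h1 (by omega) (by omega)) (fun e h1 h2 => hfadj e (by omega))
    have e2 : Linked G U (f (g + 1)) (f t) := linked_of_seq (by omega)
      (fun e h1 h2 => hUf e (by omega) (by omega) (by omega)) (fun e h1 h2 => hfadj e (by omega))
    have e3 : Linked G U (h u) (h w) := hs.linked_seq hlu huw hwr fun e h1 h2 => hUh e h1 h2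
    have e4 : Linked G U (f s) (h u) := .of_eq_or_adj (hUf s le_rfl (by omega) (by omega))
      (hUh u le_rfl huw) (hs'.imp_left Eq.symm)
    have e5 : Linked G U (f t) (h w) := .of_eq_or_adj (hUf t (by omega) le_rfl (by omega))
      (hUh w huw le_rfl) (ht'.imp_left Eq.symm)
    exact ((e1.symm.trans e4).trans e3).trans (e5.symm.trans e2.symm)
  have hole := hasHoleIn_of_split (x := f g) (U := U) (A₁ := {f (g - 1)}) (A₂ := {f (g + 1)}) ?_
    hlink ((hf.adj_iff g (by omega) _ (by omega)).2 (by omega))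
    ((hf.adj_iff g (by omega) _ (by omega)).2 (by omega)) rfl rfl ?_ ?_
  · refine hs.not_hasHoleIn_restSet ?_ hole
    rintro x (rfl | ⟨e, h1, h2, -, rfl⟩ | ⟨e, h1, h2, rfl⟩)
    · exact hfS _ (by omega)
    · exact hfS _ (by omega)
    · exact hs.mem_restSet (by omega) (by omega)
  · rintro (⟨e, h1, h2, h3, h4⟩ | ⟨e, h1, h2, h4⟩)
    · exact h3 (hf.inj _ (by omega) _ (by omega) h4).symm
    · exact (hc e h1 h2).1 h4.symm
  · rintro x (⟨e, h1, h2, h3, rfl⟩ | ⟨e, h1, h2, rfl⟩) hadj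
    · rcases (hf.adj_iff g (by omega) e (by omega)).1 hadj with h4 | h4
      · right; rw [← h4]; rfl
      · left; rw [show e = g - 1 by omega]; rfl
    · exact absurd hadj (hc e h1 h2).2
  · rintro x hx y hy - - - -
    obtain rfl := Set.mem_singleton_iff.1 hx
    obtain rfl := Set.mem_singleton_iff.1 hy
    refine ⟨fun e => ?_, fun e => ?_⟩
    · have := hf.inj _ (by omega) _ (by omega) e
      omega
    · have := (hf.adj_iff _ (by omega) _ (by omega)).1 e
      omega

/-- The vertices of `V₀` that are close to `h i`. -/
def closeSet (G : SimpleGraph V) (M : Finset V) (n : ℕ) (h : ℕ → V) (i : ℕ) : Set V :=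
  {w | w ∈ restSet G M n h ∧ ∃ c, i ≤ c + 3 ∧ c ≤ i + 3 ∧ (h c = w ∨ G.Adj w (h c))}

/-- An induced path through `z` comes close to `h (i - 3)` before `z` and to `h (i + 3)` after it.
The shortcut `h (i - 3), a, h (i + 3)` closes that stretch around `z`, and since `a` misses `z` a
hole through `z` arises. As `G - M` has no hole, `a ∈ M`. The margins in `hi` and `hir` keep both
path vertices strictly inside the path. -/
theorem hasHoleIn_of_detour (hs : HoleSetting G M n h l r) {i : ℕ} (hi : l + 6 ≤ i)
    (hir : i + 4 ≤ r) {z a : V} (hz : z ∈ V2 G (restSet G M n h) (h l) (h r))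
    (hzi : G.Adj (h i) z) (ha : a ∈ commonSeq G n h) (hza : ¬ G.Adj z a) :
    a ∈ M ∧ HasHoleIn G (insert a (closeSet G M n h i)) := by
  have hrn := hs.lt
  obtain ⟨Q, hQp, hQc, hQS, hzQ⟩ := hz
  have hf := isPathSeq_getVert hQp hQc
  have hfS : ∀ t ≤ Q.length, Q.getVert t ∈ restSet G M n h :=
    fun t _ => hQS _ (Q.getVert_mem_support t)
  have hf0 : Q.getVert 0 = h l := by simp
  have hfm : Q.getVert Q.length = h r := by simp
  obtain ⟨e, rfl, hem⟩ := SimpleGraph.Walk.mem_support_iff_exists_getVert.1 hzQ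
  generalize Q.length = m at *
  generalize Q.getVert = f at *
  have hfadj : ∀ e < m, G.Adj (f e) (f (e + 1)) := fun e he =>
    (hf.adj_iff e (by omega) (e + 1) (by omega)).2 (Or.inl rfl)
  have hfar : ∀ c, c + 3 = i ∨ c = i + 3 → ¬ (h c = f e ∨ G.Adj (f e) (h c)) := by
    intro c hc hce
    have := hs.index_le (hfS e hem).2 (i := i) (j := c) (by omega) (by omega) (by omega) (by omega)
      (Or.inr hzi.symm) hce
    omega
  obtain ⟨s, hse, hs'⟩ : ∃ s < e, h (i - 3) = f s ∨ G.Adj (f s) (h (i - 3)) := by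
    obtain ⟨z, ⟨s, hse, rfl⟩, hz⟩ := hs.exists_eq_or_adj (Z := {x | ∃ s ≤ e, x = f s})
      (by rintro x ⟨s, h1, rfl⟩; exact hfS s (by omega))
      (linked_of_seq (f := f) (i := 0) (j := e) (by omega) (fun t _ h2 => ⟨t, h2, rfl⟩)
        (fun t _ h2 => hfadj t (by omega)))
      (u := l) (c := i - 3) (w := i) le_rfl (by omega) (by omega) (by omega) (Or.inl hf0.symm)
      (Or.inr hzi.symm)
    rcases hse.lt_or_eq with h1 | rfl
    · exact ⟨s, h1, hz⟩
    · exact absurd hz (hfar (i - 3) (by omega))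
  obtain ⟨t, het, htm, ht'⟩ : ∃ t, e < t ∧ t ≤ m ∧ (h (i + 3) = f t ∨ G.Adj (f t) (h (i + 3))) := by
    obtain ⟨z, ⟨t, het, htm, rfl⟩, hz⟩ := hs.exists_eq_or_adj (Z := {x | ∃ t, e ≤ t ∧ t ≤ m ∧ x = f t})
      (by rintro x ⟨t, -, h1, rfl⟩; exact hfS t h1)
      (linked_of_seq (f := f) (i := e) (j := m) (by omega) (fun t h1 h2 => ⟨t, h1, h2, rfl⟩)
        (fun t _ h2 => hfadj t (by omega)))
      (u := i) (c := i + 3) (w := r) (by omega) (by omega) (by omega) (by omega)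
      (Or.inr hzi.symm) (Or.inl hfm.symm)
    rcases het.lt_or_eq with h1 | rfl
    · exact ⟨t, h1, htm, hz⟩
    · exact absurd hz (hfar (i + 3) (by omega))
  -- The detour cannot stray: between its two contacts every vertex is close to some `h c` with `c`
  -- within three of `i`.
  have hclose : ∀ g, s ≤ g → g ≤ t → f g ∈ closeSet G M n h i := by
    intro g h1 h2
    obtain ⟨c, hc1, hc2, hc3⟩ := hs.detour_index hf hfS (u := i - 3) (w := i + 3) (by omega)
      (by omega) (by omega) hs' ht' h1 h2 htm
    exact ⟨hfS g (by omega), c, by omega, by omega, hc3⟩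
  have hcloseh : ∀ c, i ≤ c + 3 → c ≤ i + 3 → h c ∈ closeSet G M n h i := fun c h1 h2 =>
    ⟨hs.mem_restSet (by omega) (by omega), c, h1, h2, Or.inl rfl⟩
  let U : Set V := {x | ∃ g, s ≤ g ∧ g ≤ t ∧ g ≠ e ∧ x = f g} ∪ {a, h (i - 3), h (i + 3)}
  have hUf : ∀ g, s ≤ g → g ≤ t → g ≠ e → f g ∈ U := fun e h1 h2 h3 => Or.inl ⟨e, h1, h2, h3, rfl⟩
  have hUa : a ∈ U := Or.inr (by simp)
  have hU1 : h (i - 3) ∈ U := Or.inr (by simp)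
  have hU2 : h (i + 3) ∈ U := Or.inr (by simp)
  have hlink : Linked G U (f (e - 1)) (f (e + 1)) := by
    have e1 : Linked G U (f s) (f (e - 1)) := linked_of_seq (by omega)
      (fun e h1 h2 => hUf e h1 (by omega) (by omega)) (fun e h1 h2 => hfadj e (by omega))
    have e2 : Linked G U (f (e + 1)) (f t) := linked_of_seq (by omega)
      (fun e h1 h2 => hUf e (by omega) (by omega) (by omega)) (fun e h1 h2 => hfadj e (by omega))
    have e3 : Linked G U (h (i - 3)) (h (i + 3)) :=
      (Linked.of_adj hU1 hUa (ha _ (by omega)).symm).trans (.of_adj hUa hU2 (ha _ (by omega)))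
    have e4 : Linked G U (f s) (h (i - 3)) := .of_eq_or_adj (hUf s le_rfl (by omega) (by omega))
      hU1 (hs'.imp_left Eq.symm)
    have e5 : Linked G U (f t) (h (i + 3)) := .of_eq_or_adj (hUf t (by omega) le_rfl (by omega))
      hU2 (ht'.imp_left Eq.symm)
    exact ((e1.symm.trans e4).trans e3).trans (e5.symm.trans e2.symm)
  have hole : HasHoleIn G (insert (f e) U) := by
    refine hasHoleIn_of_split (x := f e) (U := U) (A₁ := {f (e - 1)}) (A₂ := {f (e + 1)}) ?_
      hlink ((hf.adj_iff e (by omega) _ (by omega)).2 (by omega))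
      ((hf.adj_iff e (by omega) _ (by omega)).2 (by omega)) rfl rfl ?_ ?_
    · rintro (⟨g, h1, h2, h3, h4⟩ | h4 | h4 | h4)
      · exact h3 (hf.inj _ (by omega) _ (by omega) h4).symm
      · exact (hfS e hem).2 (h4 ▸ ha)
      · exact hfar (i - 3) (by omega) (Or.inl h4.symm)
      · exact hfar (i + 3) (by omega) (Or.inl h4.symm)
    · rintro x (⟨g, h1, h2, h3, rfl⟩ | rfl | rfl | rfl) hadj
      · rcases (hf.adj_iff e (by omega) g (by omega)).1 hadj with h4 | h4
        · right; rw [← h4]; rfl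
        · left; rw [show g = e - 1 by omega]; rfl
      · exact absurd hadj hza
      · exact absurd (Or.inr hadj) (hfar (i - 3) (by omega))
      · exact absurd (Or.inr hadj) (hfar (i + 3) (by omega))
    · rintro x hx y hy - - - -
      obtain rfl := Set.mem_singleton_iff.1 hx
      obtain rfl := Set.mem_singleton_iff.1 hy
      refine ⟨fun he => ?_, fun he => ?_⟩
      · have := hf.inj _ (by omega) _ (by omega) he
        omega
      · have := (hf.adj_iff _ (by omega) _ (by omega)).1 he
        omega
  have hole' : HasHoleIn G (insert a (closeSet G M n h i)) := by
    refine hole.mono ?_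
    rintro x (rfl | ⟨g, h1, h2, h3, rfl⟩ | rfl | rfl | rfl)
    · exact Or.inr (hclose e (by omega) (by omega))
    · exact Or.inr (hclose g h1 h2)
    · exact Or.inl rfl
    · exact Or.inr (hcloseh _ (by omega) (by omega))
    · exact Or.inr (hcloseh _ (by omega) (by omega))
  refine ⟨?_, hole'⟩
  by_contra haM
  refine hs.not_hasHoleIn (hole'.mono ?_)
  rintro x (rfl | hx)
  · exact haM
  · exact hx.1.1

/-- A common vertex would be close to indices at most `i + 3` and at least `j - 3`, which differ by
at least three. -/
theorem closeSet_disjoint (hs : HoleSetting G M n h l r) {i j : ℕ} (hi : 6 ≤ i) (hij : i + 9 ≤ j)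
    (hj : j + 3 ≤ r) {w : V} (hw : w ∈ closeSet G M n h i) : w ∉ closeSet G M n h j := by
  have := hs.lt
  rintro ⟨-, c, h1, h2, h3⟩
  obtain ⟨hwS, c', h1', h2', h3'⟩ := hw
  have := hs.index_le hwS.2 (i := c') (j := c) (by omega) (by omega) (by omega) (by omega) h3' h3
  omega

end HoleSetting

/-! ### Branches -/

/-- The inner bag `D` is a clique through `v` lying in `V₁`, so a neighbor of `C` in it that is not
in `V₂` would belong to the component `C`. If `C` had no neighbor in `S`, the walk from `C` to `a`
would put `a ∈ V₂` into `C`. -/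
theorem IsBranchNear.isNearSet {G : SimpleGraph V} {S : Set V} {T : SimpleGraph (Bag G S)}
    {a b v : V} {C : Set V} (hC : IsBranchNear T a b v C) (ha : a ∈ V2 G S a b)
    (hb : b ∈ V2 G S a b) (haS : a ∈ S) (hbS : b ∈ S) (hav : Linked G S a v) :
    IsNearSet G S (V2 G S a b) v C := by
  obtain ⟨K, L, W, -, ⟨hCV, hconn, hcomp⟩, D, hD, hvD, hCD⟩ := hC
  have hV1S : V1 a b W ⊆ S := by
    rintro z (rfl | rfl | ⟨⟨B, -, hzB⟩, -⟩)
    · exact haS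
    · exact hbS
    · exact B.2.prop.1 hzB
  have hDin : D ∈ innerSubtree W :=
    ⟨D, hD, .nil, by simpa using hD.2.1.symm, by simpa using hD.2.2.symm⟩
  have hDeq : ∀ y ∈ D.1, v = y ∨ G.Adj y v := fun y hy => by
    by_cases h : v = y
    · exact Or.inl h
    · exact Or.inr (D.2.prop.2 hy hvD (Ne.symm h))
  have hDV1 : D.1 ⊆ V1 a b W := by
    intro y hy
    refine Or.inr (Or.inr ⟨⟨D, hDin, hy⟩, ?_⟩)
    exact hav.trans (.of_eq_or_adj (D.2.prop.1 hvD) (D.2.prop.1 hy)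
      ((hDeq y hy).imp_right fun e => e.symm))
  refine ⟨fun c hc => hV1S (hCV hc).1, fun c hc => (hCV hc).2,
    fun u hu w hw => linked_of_connected hconn hu hw, fun y hy => ?_,
    D.2.prop.2.subset hCD, fun y hy => hDeq y (hCD hy), ?_⟩
  · by_contra hy2
    obtain ⟨c, hc, hcy⟩ := hy.1.2
    exact hy.1.1 (hcomp c hc y ⟨hDV1 (hCD hy), hy2⟩ hcy)
  · obtain ⟨⟨c, hc⟩⟩ := hconn.nonempty
    by_contra hne
    rcases (hCV hc).1 with rfl | rfl | ⟨-, Q⟩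
    · exact (hCV hc).2 ha
    · exact (hCV hc).2 hb
    · refine (hCV (Linked.mem_of_closed (C := C) (Linked.symm Q) hc fun x hx y hy hxy => ?_)).2 ha
      by_contra hyC
      exact hne ⟨y, ⟨hyC, x, hx, hxy⟩, hy⟩

namespace HoleSetting

variable {G : SimpleGraph V} {M : Finset V} {n : ℕ} {h : ℕ → V} {l r : ℕ}

/-- Here `N(C)` is a clique: its part in `V₀` is one, it is completely joined to `A`, and `A` is a
clique. So non-simpliciality comes from a hole in `N[C]`. That hole meets `M`, necessarily in `A`;
two further vertices in `A ∖ M` would form a triangle with that vertex. -/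
theorem exists_hole_of_not_isSimplicialSet (hs : HoleSetting G M n h l r) {i : ℕ}
    (hr : i ≤ r) {C : Set V}
    (hC : IsNearSet G (restSet G M n h) (V2 G (restSet G M n h) (h l) (h r)) (h i) C)
    (hCM : ¬ AdjSets G C (↑M \ commonSeq G n h))
    (hcc : CompletelyConnected G
      {z | z ∈ V2 G (restSet G M n h) (h l) (h r) ∧ G.Adj (h i) z} (commonSeq G n h))
    (hns : ¬ IsSimplicialSet G C) :
    ∃ F : Set V, HasHoleIn G F ∧ F ⊆ (C ∪ nbhd G C ∩ restSet G M n h) ∪ commonSeq G n h ∧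
      ∀ a ∈ F, ∀ b ∈ F, a ∈ commonSeq G n h → b ∈ commonSeq G n h → a ∉ M → b ∉ M → a = b := by
  have hrn := hs.lt
  have hsplit : ∀ y ∈ nbhd G C, y ∈ restSet G M n h ∨ y ∈ commonSeq G n h := by
    intro y hy
    by_cases hyA : y ∈ commonSeq G n h
    · exact Or.inr hyA
    · refine Or.inl ⟨fun hyM => hCM ?_, hyA⟩
      obtain ⟨c, hc, hcy⟩ := hy.2
      exact ⟨c, hc, y, ⟨hyM, hyA⟩, hcy⟩
  have hAA : ∀ a ∈ commonSeq G n h, ∀ b ∈ commonSeq G n h, a ≠ b → G.Adj a b :=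
    fun a ha b hb hab => hs.shortest.adj_of_common hs.five_le ha hb hab
  have hSA : ∀ y ∈ nbhd G C ∩ restSet G M n h, ∀ a ∈ commonSeq G n h, G.Adj y a := by
    intro y hy a ha
    rcases hC.eq_or_adj y hy with rfl | h1
    · exact (ha i (by omega)).symm
    · exact hcc y ⟨hC.nbhd_subset hy, h1.symm⟩ a ha
  have hclique : G.IsClique (nbhd G C) := by
    intro x hx y hy hxy
    rcases hsplit x hx with h1 | h1 <;> rcases hsplit y hy with h2 | h2
    · exact hC.isClique ⟨hx, h1⟩ ⟨hy, h2⟩ hxy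
    · exact hSA x ⟨hx, h1⟩ y h2
    · exact (hSA y ⟨hy, h2⟩ x h1).symm
    · exact hAA x h1 y h2 hxy
  have hhole : HasHoleIn G (C ∪ nbhd G C) := by
    by_contra hno
    exact hns ⟨isChordal_induce_iff.2 hno, hclique⟩
  obtain ⟨n', g, hg, hgU⟩ := hhole
  have h4 := hg.four_le
  have hsub : ∀ t < n', g t ∈ (C ∪ nbhd G C ∩ restSet G M n h) ∪ commonSeq G n h := by
    intro t ht
    rcases hgU t ht with h1 | h1
    · exact Or.inl (Or.inl h1)
    · exact (hsplit _ h1).imp (fun h2 => Or.inr ⟨h1, h2⟩) id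
  obtain ⟨u, hu, huM⟩ : ∃ u < n', g u ∈ M := by
    by_contra hno
    push Not at hno
    exact hs.not_hasHoleIn ⟨n', g, hg, hno⟩
  have huA : g u ∈ commonSeq G n h := by
    rcases hsub u hu with (h1 | h1) | h1
    · exact absurd huM (hC.subset h1).1
    · exact absurd huM h1.2.1
    · exact h1
  refine ⟨{x | ∃ t < n', x = g t}, ⟨n', g, hg, fun t ht => ⟨t, ht, rfl⟩⟩, ?_, ?_⟩
  · rintro x ⟨t, ht, rfl⟩
    exact hsub t ht
  · rintro a ⟨s, hsn, rfl⟩ b ⟨t, htn, rfl⟩ haA hbA haM hbM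
    by_contra hne
    have e1 := (hg.adj_iff s hsn t htn).1 (hAA _ haA _ hbA hne)
    have e2 := (hg.adj_iff s hsn u hu).1 (hAA _ haA _ huA fun e => haM (e ▸ huM))
    have e3 := (hg.adj_iff t htn u hu).1 (hAA _ hbA _ huA fun e => hbM (e ▸ huM))
    omega

/-! ### Solutions -/

/-- A solution does not delete an edge between two common neighbors of a long hole, unless
it deletes one of the two. -/
theorem not_mem_of_common (hs : HoleSetting G M n h l r) {k₁ k₂ k₃ : ℕ} {Vd : Finset V}
    {Ed Ea : Finset (Sym2 V)} (hsol : IsSolution G k₁ k₂ k₃ M Vd Ed Ea)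
    (hn : 4 * (k₁ + k₂ + k₃ + 1) ≤ n) {a a' : V} (ha : a ∈ commonSeq G n h)
    (ha' : a' ∈ commonSeq G n h) (had : a ∉ Vd) (had' : a' ∉ Vd) : s(a, a') ∉ Ed := by
  classical
  intro he
  obtain ⟨⟨hEd, hEa, hch⟩, h1, h2, h3, -⟩ := hsol
  have hadj : G.Adj a a' := hEd he
  have hEa' : ∀ u v, s(u, v) ∈ Ea → u ≠ v ∧ ¬ G.Adj u v := fun u v huv => by
    have := hEa huv
    rw [SimpleGraph.mem_edgeSet, SimpleGraph.compl_adj] at this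
    exact this
  have hset : ({s(a, a')} : Set (Sym2 V)) ∪ ((Ed.erase s(a, a') : Finset (Sym2 V)) : Set (Sym2 V)) =
      (Ed : Set (Sym2 V)) := by
    rw [Finset.coe_erase, Set.union_sdiff_cancel (by simpa using he)]
  -- Delete the edge beforehand. The remaining edits must destroy the `k₁ + k₂ + k₃ + 1` four-cycles
  -- `a, h (4j), a', h (4j + 2)`, which share only `a` and `a'`.
  have hsol' : IsChordalEditingSet (G.deleteEdges {s(a, a')}) Vd (Ed.erase s(a, a')) Ea := by
    refine ⟨fun e hee => ?_, fun e hee => ?_, ?_⟩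
    · rw [SimpleGraph.edgeSet_deleteEdges]
      rw [Finset.mem_coe, Finset.mem_erase] at hee
      exact ⟨hEd hee.2, hee.1⟩
    · induction e with
      | h u v =>
        obtain ⟨h4, h5⟩ := hEa' u v hee
        rw [SimpleGraph.mem_edgeSet, SimpleGraph.compl_adj]
        exact ⟨h4, fun h6 => h5 (SimpleGraph.deleteEdges_adj.1 h6).1⟩
    · unfold edited at hch ⊢
      rwa [SimpleGraph.deleteEdges_deleteEdges, hset]
  have hhn : ∀ i < n, h i ≠ a ∧ h i ≠ a' := fun i hi =>
    ⟨fun e => G.loopless.irrefl a (e ▸ ha i hi), fun e => G.loopless.irrefl a' (e ▸ ha' i hi)⟩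
  have hle := hsol'.card_le (Finset.range (k₁ + k₂ + k₃ + 1))
    (fun j => ({a, a', h (4 * j), h (4 * j + 2)} : Set V)) {a, a'} ?_ ?_ ?_ ?_ ?_
  · have := Finset.card_erase_le (s := Ed) (a := s(a, a'))
    rw [Finset.card_range] at hle
    omega
  · intro j hj
    rw [Finset.mem_range] at hj
    have hd : ∀ x i, (x = a ∨ x = a') → i < n → (G.deleteEdges {s(a, a')}).Adj x (h i) := by
      intro x i hx hi
      rw [SimpleGraph.deleteEdges_adj]
      refine ⟨?_, ?_⟩
      · rcases hx with rfl | rfl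
        · exact ha i hi
        · exact ha' i hi
      · simp only [Set.mem_singleton_iff, Sym2.eq_iff]
        have := hhn i hi
        tauto
    have h02 : ¬ G.Adj (h (4 * j)) (h (4 * j + 2)) := by
      have := hs.five_le
      rw [hs.shortest.isHoleSeq.adj_iff _ (by omega) _ (by omega)]; omega
    have h02' : h (4 * j) ≠ h (4 * j + 2) := fun e => by
      have := hs.shortest.isHoleSeq.inj _ (by omega) _ (by omega) e
      omega
    refine ⟨4, _, isHoleSeq_four (hd a (4 * j) (Or.inl rfl) (by omega))
      (hd a' (4 * j) (Or.inr rfl) (by omega)).symm (hd a' (4 * j + 2) (Or.inr rfl) (by omega))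
      (hd a (4 * j + 2) (Or.inl rfl) (by omega)).symm ?_ ?_ hadj.ne h02', ?_⟩
    · simp [SimpleGraph.deleteEdges_adj]
    · exact fun e => h02 (SimpleGraph.deleteEdges_adj.1 e).1
    · intro i hi
      interval_cases i <;> simp
  · intro i hi j hj hij v hv hv'
    rw [Finset.mem_range] at hi hj
    by_contra hvZ
    have hv1 : v = h (4 * i) ∨ v = h (4 * i + 2) := by
      simp only [Set.mem_insert_iff, Set.mem_singleton_iff] at hv hvZ; tauto
    have hv2 : v = h (4 * j) ∨ v = h (4 * j + 2) := by
      simp only [Set.mem_insert_iff, Set.mem_singleton_iff] at hv' hvZ; tauto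
    rcases hv1 with rfl | rfl <;> rcases hv2 with e | e <;>
    · have := hs.shortest.isHoleSeq.inj _ (by omega) _ (by omega) e
      omega
  · rintro j - v - (rfl | rfl)
    · exact had
    · exact had'
  · rintro j - u - v - hu hv huv
    rw [Finset.mem_erase] at huv
    have := (SimpleGraph.mem_edgeSet G).1 (hEd huv.2)
    rcases hu with rfl | rfl <;> rcases hv with rfl | rfl
    · exact G.loopless.irrefl _ this
    · exact huv.1 rfl
    · exact huv.1 Sym2.eq_swap
    · exact G.loopless.irrefl _ this
  · rintro j - u - v - hu hv huv
    obtain ⟨h4, h5⟩ := hEa' u v huv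
    rcases hu with rfl | rfl <;> rcases hv with rfl | rfl
    · exact h4 rfl
    · exact h5 hadj
    · exact h5 hadj.symm
    · exact h4 rfl

end HoleSetting

theorem IsSolution.not_mem_diag {G : SimpleGraph V} {k₁ k₂ k₃ : ℕ} {M : Finset V} {Vd : Finset V}
    {Ed Ea : Finset (Sym2 V)} (hsol : IsSolution G k₁ k₂ k₃ M Vd Ed Ea) (a : V) :
    s(a, a) ∉ Ed ∧ s(a, a) ∉ Ea :=
  ⟨fun he => G.loopless.irrefl a (hsol.1.1 he), fun he => Gᶜ.loopless.irrefl a (hsol.1.2.1 he)⟩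

theorem IsSolution.not_adj {G : SimpleGraph V} {k₁ k₂ k₃ : ℕ} {M : Finset V} {Vd : Finset V}
    {Ed Ea : Finset (Sym2 V)} (hsol : IsSolution G k₁ k₂ k₃ M Vd Ed Ea) {a b : V}
    (hab : s(a, b) ∈ Ea) : a ≠ b ∧ ¬ G.Adj a b := by
  have := hsol.1.2.1 hab
  rwa [SimpleGraph.mem_edgeSet, SimpleGraph.compl_adj] at this

/-- A family of holes that pairwise meet only in `Z`, each having at most one vertex in `Z`, which
is undeletable, is at most as large as any solution. -/
theorem IsSolution.card_le {G : SimpleGraph V} {k₁ k₂ k₃ : ℕ} {M : Finset V} {Vd : Finset V}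
    {Ed Ea : Finset (Sym2 V)} (hsol : IsSolution G k₁ k₂ k₃ M Vd Ed Ea) {ι : Type*} (I : Finset ι)
    (F : ι → Set V) (Z : Set V) (hF : ∀ i ∈ I, HasHoleIn G (F i))
    (hdisj : ∀ i ∈ I, ∀ j ∈ I, i ≠ j → ∀ v ∈ F i, v ∈ F j → v ∈ Z)
    (hM : ∀ i ∈ I, ∀ v ∈ F i, v ∈ Z → v ∈ M)
    (hZ : ∀ i ∈ I, ∀ u ∈ F i, ∀ v ∈ F i, u ∈ Z → v ∈ Z → u = v) : I.card ≤ k₁ + k₂ + k₃ := by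
  have hle := hsol.1.card_le I F Z hF hdisj
    (fun i hi v hv hvZ hvd => Finset.disjoint_left.1 hsol.2.2.2.2 hvd (hM i hi v hv hvZ))
    (fun i hi u hu v hv huZ hvZ => by
      rw [hZ i hi u hu v hv huZ hvZ]; exact (hsol.not_mem_diag v).1)
    (fun i hi u hu v hv huZ hvZ => by
      rw [hZ i hi u hu v hv huZ hvZ]; exact (hsol.not_mem_diag v).2)
  have := hsol.2
  omega

/-- Listing a set of indices increasingly turns differences of ranks into lower bounds for distances
along the hole, so pods can be spaced out by rank alone. -/
theorem exists_spread (J : Finset ℕ) {N : ℕ} (hN : N < J.card) :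
    ∃ e : ℕ → ℕ, (∀ a ≤ N, e a ∈ J) ∧ ∀ a b, a ≤ b → b ≤ N → e a + (b - a) ≤ e b := by
  let f := J.orderEmbOfFin (k := J.card) rfl
  let e : ℕ → ℕ := fun a => f ⟨min a N, by omega⟩
  have hstep : ∀ a < N, e a + 1 ≤ e (a + 1) := fun a ha =>
    f.strictMono (a := ⟨min a N, by omega⟩) (b := ⟨min (a + 1) N, by omega⟩)
      (by rw [Fin.mk_lt_mk]; omega)
  refine ⟨e, fun a _ => J.orderEmbOfFin_mem rfl _, fun a b hab hb => ?_⟩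
  induction b, hab using Nat.le_induction with
  | base => simp
  | succ b hab ih =>
    have h1 := ih (by omega)
    have h2 := hstep b (by omega)
    omega

namespace HoleSetting

variable {G : SimpleGraph V} {M : Finset V} {n : ℕ} {h : ℕ → V} {l r : ℕ}

/-- Many pods adjacent to the same vertex of `M ∖ A`: there is no solution. -/
theorem not_isSolution_of_pods (hs : HoleSetting G M n h l r) {k₁ k₂ k₃ : ℕ} {x : V} (hx : x ∈ M)
    (hxA : x ∉ commonSeq G n h) (J : Finset ℕ) (hJ : ∀ i ∈ J, 3 ≤ i ∧ l ≤ i ∧ i ≤ r ∧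
      ∃ X, IsPod G M n h l r i X ∧ ∃ u ∈ X, G.Adj x u)
    (hcard : 9 * (k₁ + k₂ + k₃) + 15 < J.card) {Vd : Finset V} {Ed Ea : Finset (Sym2 V)} :
    ¬ IsSolution G k₁ k₂ k₃ M Vd Ed Ea := by
  classical
  intro hsol
  have hrn := hs.lt
  obtain ⟨e, heJ, he⟩ := exists_spread J hcard
  generalize hk : k₁ + k₂ + k₃ = k at *
  choose! X hX u hu hxu using fun i hi => (hJ i hi).2.2.2
  -- Block `q` uses the pods of ranks `9q` and `9q + 6`: six apart for a hole, and three from the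
  -- next block for disjointness. The neighbors of `x` on the path are too concentrated to spoil
  -- more than one of the `k + 2` blocks.
  let bad : ℕ → Prop := fun q => ∃ t, e (9 * q) ≤ t ∧ t ≤ e (9 * q + 6) ∧ G.Adj x (h t)
  have h1 : ∀ q < k + 2, e (9 * q) ∈ J ∧ e (9 * q + 6) ∈ J ∧ e (9 * q) + 6 ≤ e (9 * q + 6) :=
    fun q hq => ⟨heJ _ (by omega), heJ _ (by omega), by
      have := he (9 * q) (9 * q + 6) (by omega) (by omega)
      omega⟩
  have h2 : ∀ q q', q < q' → q' < k + 2 → e (9 * q + 6) + 3 ≤ e (9 * q') := fun q q' hqq hq' => by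
    have := he (9 * q + 6) (9 * q') (by omega) (by omega)
    omega
  have hbad : ((Finset.range (k + 2)).filter bad).card ≤ 1 := by
    have key : ∀ q q', q < q' → q' < k + 2 → bad q → ¬ bad q' := by
      rintro q q' hqq hq' ⟨t, ht1, ht2, ht3⟩ ⟨t', ht1', ht2', ht3'⟩
      have e1 := h1 q (by omega)
      have e2 := h1 q' hq'
      have e3 := h2 q q' hqq hq'
      have j1 := hJ _ e1.1
      have j2 := hJ _ e2.2.1
      have := hs.index_le hxA (i := t) (j := t') (by omega) (by omega) (by omega) (by omega)
        (Or.inr ht3) (Or.inr ht3')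
      omega
    rw [Finset.card_le_one]
    intro q hq q' hq'
    rw [Finset.mem_filter, Finset.mem_range] at hq hq'
    rcases lt_trichotomy q q' with h3 | h3 | h3
    · exact absurd hq'.2 (key q q' h3 hq'.1 hq.2)
    · exact h3
    · exact absurd hq.2 (key q' q h3 hq.1 hq'.2)
  have hsum := Finset.card_filter_add_card_filter_not (s := Finset.range (k + 2)) bad
  rw [Finset.card_range] at hsum
  let F : ℕ → Set V := fun q => insert x (X (e (9 * q)) ∪ X (e (9 * q + 6)) ∪
    {v | ∃ t, e (9 * q) ≤ t ∧ t ≤ e (9 * q + 6) ∧ v = h t})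
  have hle := hsol.card_le ((Finset.range (k + 2)).filter fun q => ¬ bad q) F {x} ?_ ?_ ?_ ?_
  · omega
  · intro q hq
    rw [Finset.mem_filter, Finset.mem_range] at hq
    obtain ⟨e1, e2, e3⟩ := h1 q hq.1
    have j1 := hJ _ e1
    have j2 := hJ _ e2
    exact IsPod.hasHoleIn hs j1.1 j1.2.1 e3 j2.2.2.1 (hX _ e1) (hX _ e2) hx (hu _ e1) (hu _ e2)
      (hxu _ e1) (hxu _ e2) fun t ht1 ht2 ht3 => hq.2 ⟨t, ht1, ht2, ht3⟩
  · have key : ∀ q q', q < q' → q' < k + 2 → ∀ v ∈ F q, v ∈ F q' → v = x := by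
      intro q q' hqq hq' v hv hv'
      obtain ⟨e1, e2, e3⟩ := h1 q (by omega)
      obtain ⟨e1', e2', e3'⟩ := h1 q' hq'
      have e4 := h2 q q' hqq hq'
      have j1 := hJ _ e1
      have j2 := hJ _ e2
      have j1' := hJ _ e1'
      have j2' := hJ _ e2'
      rcases hv with rfl | (hv | hv) | ⟨t, ht1, ht2, rfl⟩
      · rfl
      · rcases hv' with rfl | (hv' | hv') | ⟨t', ht1', ht2', rfl⟩
        · rfl
        · exact absurd hv' (IsPod.disjoint hs j1.1 j1.2.1 (by omega) j1'.2.2.1 (hX _ e1)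
            (hX _ e1') hv)
        · exact absurd hv' (IsPod.disjoint hs j1.1 j1.2.1 (by omega) j2'.2.2.1 (hX _ e1)
            (hX _ e2') hv)
        · have := (hX _ e1).index_le _ hv t' (by omega) (by omega) (by omega) (Or.inl rfl)
          omega
      · rcases hv' with rfl | (hv' | hv') | ⟨t', ht1', ht2', rfl⟩
        · rfl
        · exact absurd hv' (IsPod.disjoint hs j2.1 j2.2.1 (by omega) j1'.2.2.1 (hX _ e2)
            (hX _ e1') hv)
        · exact absurd hv' (IsPod.disjoint hs j2.1 j2.2.1 (by omega) j2'.2.2.1 (hX _ e2)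
            (hX _ e2') hv)
        · have := (hX _ e2).index_le _ hv t' (by omega) (by omega) (by omega) (Or.inl rfl)
          omega
      · rcases hv' with hv' | (hv' | hv') | ⟨t', ht1', ht2', htt⟩
        · exact hv'
        · have := (hX _ e1').index_le _ hv' t (by omega) (by omega) (by omega) (Or.inl rfl)
          omega
        · have := (hX _ e2').index_le _ hv' t (by omega) (by omega) (by omega) (Or.inl rfl)
          omega
        · have := (hs.eq_iff (by omega) (by omega)).1 htt
          omega
    intro q hq q' hq' hne v hv hv'
    rw [Finset.mem_filter, Finset.mem_range] at hq hq'
    rcases Nat.lt_or_gt_of_ne hne with h3 | h3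
    · exact key q q' h3 hq'.1 v hv hv'
    · exact key q' q h3 hq.1 v hv' hv
  · rintro q - v - rfl
    exact hx
  · rintro q - u - v - hu hv
    exact hu.trans hv.symm

/-- Many vertices of the path with detours that avoid a common neighbor: there is no solution. -/
theorem not_isSolution_of_detours (hs : HoleSetting G M n h l r) {k₁ k₂ k₃ : ℕ} (J : Finset ℕ)
    (hJ : ∀ i ∈ J, 6 ≤ i ∧ i + 3 ≤ r ∧ ∃ a ∈ commonSeq G n h, a ∈ M ∧
      HasHoleIn G (insert a (closeSet G M n h i)))
    (hcard : 9 * (k₁ + k₂ + k₃) < J.card) {Vd : Finset V} {Ed Ea : Finset (Sym2 V)} :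
    ¬ IsSolution G k₁ k₂ k₃ M Vd Ed Ea := by
  intro hsol
  obtain ⟨e, heJ, he⟩ := exists_spread J hcard
  generalize hk : k₁ + k₂ + k₃ = k at *
  have : Nonempty V := ⟨h 0⟩
  choose! a haA haM hole using fun i hi => (hJ i hi).2.2
  have h1 : ∀ q < k + 1, e (9 * q) ∈ J := fun q hq => heJ _ (by omega)
  have hZ : ∀ q, ∀ v ∈ insert (a (e (9 * q))) (closeSet G M n h (e (9 * q))),
      v ∈ commonSeq G n h → v = a (e (9 * q)) := by
    rintro q v (hv | hv) hvA
    · exact hv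
    · exact absurd hvA hv.1.2
  have hle := hsol.card_le (Finset.range (k + 1))
    -- Rank spacing nine makes the close sets disjoint. Close sets avoid `A`, so each member meets
    -- `A` only in its own undeletable vertex.
    (fun q => insert (a (e (9 * q))) (closeSet G M n h (e (9 * q)))) (commonSeq G n h) ?_ ?_ ?_ ?_
  · rw [Finset.card_range] at hle
    omega
  · intro q hq
    exact hole _ (h1 q (Finset.mem_range.1 hq))
  · have key : ∀ q q', q < q' → q' < k + 1 → ∀ v ∈ closeSet G M n h (e (9 * q)),
        v ∉ closeSet G M n h (e (9 * q')) := by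
      intro q q' hqq hq' v hv
      have := he (9 * q) (9 * q') (by omega) (by omega)
      exact hs.closeSet_disjoint (hJ _ (h1 q (by omega))).1 (by omega) (hJ _ (h1 q' hq')).2.1 hv
    rintro q hq q' hq' hne v (rfl | hv) (hv' | hv')
    · exact haA _ (h1 q (Finset.mem_range.1 hq))
    · exact haA _ (h1 q (Finset.mem_range.1 hq))
    · exact hv' ▸ haA _ (h1 q' (Finset.mem_range.1 hq'))
    · rw [Finset.mem_range] at hq hq'
      rcases Nat.lt_or_gt_of_ne hne with h3 | h3
      · exact absurd hv' (key q q' h3 hq' v hv)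
      · exact absurd hv (key q' q h3 hq v hv')
  · intro q hq v hv hvA
    rw [hZ q v hv hvA]
    exact haM _ (h1 q (Finset.mem_range.1 hq))
  · intro q hq u hu v hv huA hvA
    rw [hZ q v hv hvA, hZ q u hu huA]

/-- Many nearly disjoint holes in pods and common neighbors, each with at most one deletable common
neighbor: there is a vertex in every solution or there is no solution. -/
theorem exists_forced_of_pod_holes (hs : HoleSetting G M n h l r) {k k₁ k₂ k₃ : ℕ}
    (hk : k = k₁ + k₂ + k₃) (hn : 4 * (k + 1) ≤ n) (J : Finset ℕ)
    (hJ : ∀ i ∈ J, 3 ≤ i ∧ l ≤ i ∧ i ≤ r ∧ ∃ X, IsPod G M n h l r i X ∧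
      ∃ F : Set V, HasHoleIn G F ∧ F ⊆ X ∪ commonSeq G n h ∧
      ∀ a ∈ F, ∀ b ∈ F, a ∈ commonSeq G n h → b ∈ commonSeq G n h → a ∉ M → b ∉ M → a = b)
    (hcard : 3 * (k * k + k) < J.card) :
    (∃ v : V, v ∉ M ∧ ∀ (Vd : Finset V) (Ed Ea : Finset (Sym2 V)),
        IsSolution G k₁ k₂ k₃ M Vd Ed Ea → v ∈ Vd) ∨
      ¬ ∃ (Vd : Finset V) (Ed Ea : Finset (Sym2 V)), IsSolution G k₁ k₂ k₃ M Vd Ed Ea := by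
  classical
  obtain ⟨e, heJ, he⟩ := exists_spread J hcard
  generalize hN : k * k + k = N at *
  choose! X hX F hole hFX hF using fun i hi => (hJ i hi).2.2.2
  have h1 : ∀ q < N + 1, e (3 * q) ∈ J := fun q hq => heJ _ (by omega)
  have hdisj : ∀ q < N + 1, ∀ q' < N + 1, q ≠ q' → ∀ v ∈ F (e (3 * q)), v ∈ F (e (3 * q')) →
      v ∈ commonSeq G n h := by
    have key : ∀ q q', q < q' → q' < N + 1 → ∀ v ∈ X (e (3 * q)), v ∉ X (e (3 * q')) := by
      intro q q' hqq hq' v hv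
      have := he (3 * q) (3 * q') (by omega) (by omega)
      have j1 := hJ _ (h1 q (by omega))
      have j2 := hJ _ (h1 q' hq')
      exact IsPod.disjoint hs j1.1 j1.2.1 (by omega) j2.2.2.1 (hX _ (h1 q (by omega)))
        (hX _ (h1 q' hq')) hv
    intro q hq q' hq' hne v hv hv'
    rcases hFX _ (h1 q hq) hv with h2 | h2
    · rcases hFX _ (h1 q' hq') hv' with h3 | h3
      · rcases Nat.lt_or_gt_of_ne hne with h4 | h4
        · exact absurd h3 (key q q' h4 hq' v h2)
        · exact absurd h2 (key q' q h4 hq v h3)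
      · exact h3
    · exact h2
  have hedit : ∀ (Vd : Finset V) (Ed Ea : Finset (Sym2 V)), IsSolution G k₁ k₂ k₃ M Vd Ed Ea →
      ∀ I ⊆ Finset.range (N + 1), (∀ q ∈ I, ∀ v ∈ F (e (3 * q)), v ∈ commonSeq G n h → v ∉ Vd) →
      I.card ≤ k := by
    intro Vd Ed Ea hsol I hI hV
    have hI' : ∀ q ∈ I, q < N + 1 := fun q hq => Finset.mem_range.1 (hI hq)
    have hle := hsol.1.card_le I (fun q => F (e (3 * q))) (commonSeq G n h)
      (fun q hq => hole _ (h1 q (hI' q hq)))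
      (fun q hq q' hq' hne => hdisj q (hI' q hq) q' (hI' q' hq') hne) hV
      (fun q hq u hu v hv huA hvA => hs.not_mem_of_common hsol (by omega) huA hvA
        (hV q hq u hu huA) (hV q hq v hv hvA))
      (fun q hq u hu v hv huA hvA huv => by
        obtain ⟨h2, h3⟩ := hsol.not_adj huv
        exact h3 (hs.shortest.adj_of_common hs.five_le huA hvA h2))
    have := hsol.2
    omega
  -- If `a` lies in more than `k` members, a solution sparing `a` deletes no common neighbor in
  -- them, since `a` is their only deletable one; by `hedit` this is too many.
  by_cases hrep : ∃ a ∈ commonSeq G n h, a ∉ M ∧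
      k < ((Finset.range (N + 1)).filter fun q => a ∈ F (e (3 * q))).card
  · obtain ⟨a, haA, haM, ha⟩ := hrep
    refine Or.inl ⟨a, haM, fun Vd Ed Ea hsol => ?_⟩
    by_contra haV
    refine absurd (hedit Vd Ed Ea hsol _ (Finset.filter_subset _ _) ?_) (not_le.2 ha)
    intro q hq v hv hvA hvV
    rw [Finset.mem_filter, Finset.mem_range] at hq
    have hvM : v ∉ M := Finset.disjoint_left.1 hsol.2.2.2.2 hvV
    rw [hF _ (h1 q hq.1) v hv a hq.2 hvA haA hvM haM] at hvV
    exact haV hvV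
  · refine Or.inr ?_
    rintro ⟨Vd, Ed, Ea, hsol⟩
    push Not at hrep
    let P : ℕ → Prop := fun q => ∀ v ∈ F (e (3 * q)), v ∈ commonSeq G n h → v ∉ Vd
    have hsum := Finset.card_filter_add_card_filter_not (s := Finset.range (N + 1)) P
    have hP := hedit Vd Ed Ea hsol ((Finset.range (N + 1)).filter P) (Finset.filter_subset _ _)
      (fun q hq => (Finset.mem_filter.1 hq).2)
    -- Members losing a common neighbor are charged to it: at most `k` deleted vertices, none in
    -- `M`, with at most `k` members each.
    have hP' : ((Finset.range (N + 1)).filter fun q => ¬ P q).card ≤ Vd.card * k := by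
      refine (Finset.card_le_card (t := (Vd.filter (· ∈ commonSeq G n h)).biUnion fun a =>
        (Finset.range (N + 1)).filter fun q => a ∈ F (e (3 * q))) ?_).trans
        ((Finset.card_biUnion_le_card_mul _ _ k ?_).trans
          (Nat.mul_le_mul_right k (Finset.card_filter_le _ _)))
      · intro q hq
        rw [Finset.mem_filter] at hq
        obtain ⟨hq1, hq2⟩ := hq
        simp only [P] at hq2
        push Not at hq2
        obtain ⟨v, h2, h3, h4⟩ := hq2
        exact Finset.mem_biUnion.2 ⟨v, Finset.mem_filter.2 ⟨h4, h3⟩, Finset.mem_filter.2 ⟨hq1, h2⟩⟩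
      · intro a ha
        rw [Finset.mem_filter] at ha
        exact hrep a ha.2 (Finset.disjoint_left.1 hsol.2.2.2.2 ha.1)
    rw [Finset.card_range] at hsum
    have hVk : Vd.card ≤ k := by
      have := hsol.2
      omega
    have := Nat.mul_le_mul_right k hVk
    omega

end HoleSetting

/-! ### Junctions -/

theorem V2_comm (G : SimpleGraph V) (S : Set V) (a b : V) : V2 G S a b = V2 G S b a := by
  have key : ∀ a b : V, V2 G S a b ⊆ V2 G S b a := by
    rintro a b z ⟨Q, h1, h2, h3, h4⟩
    refine ⟨Q.reverse, h1.reverse, ?_, by simpa using h3, by simpa using h4⟩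
    rw [SimpleGraph.Walk.isChordless_iff_forall_mem_edges] at h2 ⊢
    intro u v hu hv huv
    rw [SimpleGraph.Walk.edges_reverse, List.mem_reverse]
    exact h2 (by simpa using hu) (by simpa using hv) huv
  exact (key a b).antisymm (key b a)

theorem innerBags_reverse {G : SimpleGraph V} {S : Set V} {T : SimpleGraph (Bag G S)}
    {K L : Bag G S} (W : T.Walk K L) : innerBags W.reverse = innerBags W := by
  ext B
  simp only [innerBags, SimpleGraph.Walk.support_reverse, List.mem_reverse, Set.mem_ofPred_eq]
  tauto

theorem innerSubtree_reverse {G : SimpleGraph V} {S : Set V} {T : SimpleGraph (Bag G S)}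
    {K L : Bag G S} (W : T.Walk K L) : innerSubtree W.reverse = innerSubtree W := by
  ext B
  simp only [innerSubtree, innerBags_reverse, Set.mem_ofPred_eq]
  exact ⟨fun ⟨D, hD, R, h1, h2⟩ => ⟨D, hD, R, h2, h1⟩, fun ⟨D, hD, R, h1, h2⟩ => ⟨D, hD, R, h2, h1⟩⟩

theorem V1_reverse {G : SimpleGraph V} {S : Set V} {T : SimpleGraph (Bag G S)} {a b : V}
    (hab : Linked G S a b) {K L : Bag G S} (W : T.Walk K L) : V1 b a W.reverse = V1 a b W := by
  ext z
  simp only [V1, innerSubtree_reverse, Set.mem_ofPred_eq]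
  have : Linked G S b z ↔ Linked G S a z := ⟨fun h => hab.trans h, fun h => hab.symm.trans h⟩
  unfold Linked at this
  rw [this]
  tauto

theorem IsBranchNear.symm {G : SimpleGraph V} {S : Set V} {T : SimpleGraph (Bag G S)} {a b v : V}
    {C : Set V} (hab : Linked G S a b) (h : IsBranchNear T a b v C) : IsBranchNear T b a v C := by
  obtain ⟨K, L, W, ⟨h1, h2, h3, h4, h5⟩, h6, h7⟩ := h
  refine ⟨L, K, W.reverse, ⟨h1.reverse, h3, h2, by simpa using h5, by simpa using h4⟩, ?_, ?_⟩
  · unfold IsBranch at h6 ⊢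
    rwa [V1_reverse hab, V2_comm G S b a]
  · rwa [innerBags_reverse]

/-- A path of `H - M` may be listed against the numbering of the hole, so the notion must not depend
on the order of its ends. -/
theorem IsJunction.symm {G : SimpleGraph V} {M : Finset V} {r : V} {H : G.Walk r r}
    {T : SimpleGraph (Bag G (V0 M H))} {a b v : V} (hab : Linked G (V0 M H) a b)
    (h : IsJunction M H T a b v) : IsJunction M H T b a v := by
  rcases h with h | ⟨C, hC, h⟩ | ⟨C, hC, h⟩ | h
  · exact Or.inl h
  · exact Or.inr (Or.inl ⟨C, hC.symm hab, h⟩)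
  · exact Or.inr (Or.inr (Or.inl ⟨C, hC.symm hab, h⟩))
  · rw [V2_comm] at h
    exact Or.inr (Or.inr (Or.inr h))

theorem V0_eq_restSet {G : SimpleGraph V} {M : Finset V} {n : ℕ} {h : ℕ → V} {v₀ : V}
    {H : G.Walk v₀ v₀} (hA : commonNbrs H = commonSeq G n h) : V0 M H = restSet G M n h := by
  unfold V0 restSet
  rw [hA]

namespace HoleSetting

variable {G : SimpleGraph V} {M : Finset V} {n : ℕ} {h : ℕ → V} {l r : ℕ}

/-- What a junction that is not close to an end of the path provides. -/
theorem cases_of_isJunction (hs : HoleSetting G M n h l r) {v₀ : V} {H : G.Walk v₀ v₀}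
    (hA : commonNbrs H = commonSeq G n h) {T : SimpleGraph (Bag G (V0 M H))} {i : ℕ}
    (hl : l + 6 ≤ i) (hr : i + 4 ≤ r) (hj : IsJunction M H T (h l) (h r) (h i)) :
    (∃ x ∈ M, x ∉ commonSeq G n h ∧ ∃ X, IsPod G M n h l r i X ∧ ∃ u ∈ X, G.Adj x u) ∨
    (∃ X, IsPod G M n h l r i X ∧ ∃ F : Set V, HasHoleIn G F ∧ F ⊆ X ∪ commonSeq G n h ∧
      ∀ a ∈ F, ∀ b ∈ F, a ∈ commonSeq G n h → b ∈ commonSeq G n h → a ∉ M → b ∉ M → a = b) ∨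
    ∃ a ∈ commonSeq G n h, a ∈ M ∧ HasHoleIn G (insert a (closeSet G M n h i)) := by
  have hS : V0 M H = restSet G M n h := V0_eq_restSet hA
  have hnear : ∀ C, IsBranchNear T (h l) (h r) (h i) C →
      IsNearSet G (restSet G M n h) (V2 G (restSet G M n h) (h l) (h r)) (h i) C := by
    intro C hC
    rw [← hS]
    refine hC.isNearSet ?_ ?_ ?_ ?_ ?_ <;> rw [hS]
    · exact hs.mem_V2 le_rfl (by omega)
    · exact hs.mem_V2 (by omega) le_rfl
    · exact hs.mem_restSet le_rfl (by omega)
    · exact hs.mem_restSet (by omega) le_rfl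
    · exact hs.linked_seq le_rfl (by omega) (by omega)
        fun t h1 h2 => hs.mem_restSet h1 (by omega)
  -- Conditions 4 and 2 are decided first, because the treatment of a non-simplicial branch needs
  -- both to fail.
  by_cases h4 : CompletelyConnected G
      {z | z ∈ V2 G (restSet G M n h) (h l) (h r) ∧ G.Adj (h i) z} (commonSeq G n h)
  · by_cases h2 : ∃ C, IsBranchNear T (h l) (h r) (h i) C ∧ AdjSets G C (↑M \ commonSeq G n h)
    · obtain ⟨C, hC, c, hc, x, hx, hcx⟩ := h2
      exact Or.inl ⟨x, hx.1, hx.2, _, hs.isPod_nearSet (by omega) (by omega) (by omega) (hnear C hC),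
        c, Or.inr (Or.inl hc), hcx.symm⟩
    · unfold IsJunction at hj
      rw [hA] at hj
      rcases hj with ⟨B, hiB, y, hy, x, hx, hyx⟩ | hj | ⟨C, hC, hj⟩ | hj
      · have hyi : h i = y ∨ G.Adj y (h i) := by
          by_cases he : h i = y
          · exact Or.inl he
          · exact Or.inr (B.2.prop.2 hy hiB (Ne.symm he))
        exact Or.inl ⟨x, hx.1, hx.2, _, hs.isPod_pair (by omega) (by omega) (by omega)
          (hS ▸ B.2.prop.1 hy) hyi, y, by simp, hyx.symm⟩
      · exact absurd hj h2
      · obtain ⟨F, h5, h6, h7⟩ := hs.exists_hole_of_not_isSimplicialSet (by omega)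
          (hnear C hC) (fun h => h2 ⟨C, hC, h⟩) h4 hj
        exact Or.inr (Or.inl ⟨_, hs.isPod_nearSet (by omega) (by omega) (by omega) (hnear C hC), F,
          h5, h6.trans (Set.union_subset_union_left _ (Set.subset_insert _ _)), h7⟩)
      · rw [hS] at hj
        exact absurd h4 hj
  · unfold CompletelyConnected at h4
    push Not at h4
    obtain ⟨z, hz, a, ha, hza⟩ := h4
    obtain ⟨h5, h6⟩ := hs.hasHoleIn_of_detour hl hr hz.1 hz.2 ha hza
    exact Or.inr (Or.inr ⟨a, ha, h5, h6⟩)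

theorem exists_forced_of_junctions (hs : HoleSetting G M n h l r) {v₀ : V} {H : G.Walk v₀ v₀}
    (hA : commonNbrs H = commonSeq G n h) {T : SimpleGraph (Bag G (V0 M H))} {k k₁ k₂ k₃ : ℕ}
    (hk : k = k₁ + k₂ + k₃) (hM : M.card ≤ k + 1) (J : Finset ℕ)
    (hJ : ∀ i ∈ J, l ≤ i ∧ i ≤ r ∧ IsJunction M H T (h l) (h r) (h i))
    (hcard : 12 * k ^ 2 + 87 * k + 75 < J.card) :
    (∃ v : V, v ∉ M ∧ ∀ (Vd : Finset V) (Ed Ea : Finset (Sym2 V)),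
        IsSolution G k₁ k₂ k₃ M Vd Ed Ea → v ∈ Vd) ∨
      ¬ ∃ (Vd : Finset V) (Ed Ea : Finset (Sym2 V)), IsSolution G k₁ k₂ k₃ M Vd Ed Ea := by
  classical
  have h1 := hs.one_le
  have hrn := hs.lt
  let inner : ℕ → Prop := fun i => l + 6 ≤ i ∧ i + 4 ≤ r
  let pods : V → ℕ → Prop := fun x i => ∃ X, IsPod G M n h l r i X ∧ ∃ u ∈ X, G.Adj x u
  let holes : ℕ → Prop := fun i => ∃ X, IsPod G M n h l r i X ∧
    ∃ F : Set V, HasHoleIn G F ∧ F ⊆ X ∪ commonSeq G n h ∧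
      ∀ a ∈ F, ∀ b ∈ F, a ∈ commonSeq G n h → b ∈ commonSeq G n h → a ∉ M → b ∉ M → a = b
  let detours : ℕ → Prop := fun i =>
    ∃ a ∈ commonSeq G n h, a ∈ M ∧ HasHoleIn G (insert a (closeSet G M n h i))
  let J' := J.filter inner
  have hJ' : ∀ i ∈ J', i ∈ J ∧ l + 6 ≤ i ∧ i + 4 ≤ r := fun i hi => Finset.mem_filter.1 hi
  -- The junctions have distinct indices below `n`, so their number already makes the hole long.
  have hn : 4 * (k + 1) ≤ n := by
    have : J ⊆ Finset.range n := fun i hi => Finset.mem_range.2 (by have := hJ i hi; omega)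
    have := Finset.card_le_card this
    rw [Finset.card_range] at this
    have := Nat.zero_le (k ^ 2)
    omega
  by_cases hpods : ∃ x ∈ M, x ∉ commonSeq G n h ∧ 9 * k + 15 < (J'.filter (pods x)).card
  · obtain ⟨x, hxM, hxA, hx⟩ := hpods
    refine Or.inr fun ⟨Vd, Ed, Ea, hsol⟩ => ?_
    refine hs.not_isSolution_of_pods hxM hxA (J'.filter (pods x)) (fun i hi => ?_) (by omega) hsol
    rw [Finset.mem_filter] at hi
    have := hJ' i hi.1
    exact ⟨by omega, by omega, by omega, hi.2⟩
  by_cases hholes : 3 * (k * k + k) < (J'.filter holes).card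
  · refine hs.exists_forced_of_pod_holes hk hn (J'.filter holes) (fun i hi => ?_) hholes
    rw [Finset.mem_filter] at hi
    have := hJ' i hi.1
    exact ⟨by omega, by omega, by omega, hi.2⟩
  by_cases hdet : 9 * k < (J'.filter detours).card
  · refine Or.inr fun ⟨Vd, Ed, Ea, hsol⟩ => ?_
    refine hs.not_isSolution_of_detours (J'.filter detours) (fun i hi => ?_) (by omega) hsol
    rw [Finset.mem_filter] at hi
    have := hJ' i hi.1
    exact ⟨by omega, by omega, hi.2⟩
  exfalso
  push Not at hpods
  have hcover : J ⊆ (Finset.Ico l (l + 6) ∪ Finset.Ioc (r - 4) r) ∪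
      ((M.filter (· ∉ commonSeq G n h)).biUnion (fun x => J'.filter (pods x)) ∪
        (J'.filter holes ∪ J'.filter detours)) := by
    intro i hi
    have hi' := hJ i hi
    simp only [Finset.mem_union, Finset.mem_Ico, Finset.mem_Ioc, Finset.mem_biUnion,
      Finset.mem_filter]
    by_cases hin : inner i
    · have hiJ : i ∈ J' := Finset.mem_filter.2 ⟨hi, hin⟩
      rcases hs.cases_of_isJunction hA hin.1 hin.2 hi'.2.2 with ⟨x, hxM, hxA, hx⟩ | hx | hx
      · exact Or.inr (Or.inl ⟨x, ⟨hxM, hxA⟩, hiJ, hx⟩)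
      · exact Or.inr (Or.inr (Or.inl ⟨hiJ, hx⟩))
      · exact Or.inr (Or.inr (Or.inr ⟨hiJ, hx⟩))
    · simp only [inner] at hin
      left
      omega
  have c1 := Finset.card_le_card hcover
  have c2 : ((M.filter (· ∉ commonSeq G n h)).biUnion (fun x => J'.filter (pods x))).card ≤
      (k + 1) * (9 * k + 15) :=
    (Finset.card_biUnion_le_card_mul _ _ (9 * k + 15) fun x hx => by
      rw [Finset.mem_filter] at hx
      exact hpods x hx.1 hx.2).trans
      (Nat.mul_le_mul_right _ ((Finset.card_filter_le _ _).trans hM))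
  have c3 := Finset.card_union_le (Finset.Ico l (l + 6) ∪ Finset.Ioc (r - 4) r)
      ((M.filter (· ∉ commonSeq G n h)).biUnion (fun x => J'.filter (pods x)) ∪
        (J'.filter holes ∪ J'.filter detours))
  have c4 := Finset.card_union_le (Finset.Ico l (l + 6)) (Finset.Ioc (r - 4) r)
  have c5 := Finset.card_union_le
      ((M.filter (· ∉ commonSeq G n h)).biUnion (fun x => J'.filter (pods x)))
      (J'.filter holes ∪ J'.filter detours)
  have c6 := Finset.card_union_le (J'.filter holes) (J'.filter detours)
  rw [Nat.card_Ico, Nat.card_Ioc] at c4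
  -- Six discarded indices at the left end, four at the right, then the bounds for the three kinds
  -- of junctions.
  have c7 : J.card ≤ 10 + ((k + 1) * (9 * k + 15) + (3 * (k * k + k) + 9 * k)) := by omega
  nlinarith

end HoleSetting

/-! ### Segments -/

/-- The vertices `h l, …, h r` form a component of the hole `h` minus `M`, where `h 0 ∈ M`. -/
structure IsRun (M : Finset V) (n : ℕ) (h : ℕ → V) (l r : ℕ) : Prop where
  one_le : 1 ≤ l
  le : l ≤ r
  lt : r < n
  pred_mem : h (l - 1) ∈ M
  succ_mem : r + 1 = n ∨ h (r + 1) ∈ M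
  notMem : ∀ i, l ≤ i → i ≤ r → h i ∉ M

theorem IsRun.unique {M : Finset V} {n : ℕ} {h : ℕ → V} {l r l' r' i : ℕ} (hr : IsRun M n h l r)
    (hr' : IsRun M n h l' r') (h1 : l ≤ i) (h2 : i ≤ r) (h3 : l' ≤ i) (h4 : i ≤ r') :
    l = l' ∧ r = r' := by
  have key : ∀ {l r l' r' : ℕ}, IsRun M n h l r → IsRun M n h l' r' → l ≤ i → i ≤ r → l' ≤ i →
      i ≤ r' → l ≤ l' ∧ r' ≤ r := by
    intro l r l' r' hr hr' h1 h2 h3 h4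
    have := hr.one_le
    have := hr'.lt
    constructor
    · by_contra hc
      exact hr'.notMem (l - 1) (by omega) (by omega) hr.pred_mem
    · by_contra hc
      rcases hr.succ_mem with h5 | h5
      · omega
      · exact hr'.notMem (r + 1) (by omega) (by omega) h5
  have e1 := key hr hr' h1 h2 h3 h4
  have e2 := key hr' hr h3 h4 h1 h2
  omega

/-- A walk on the integers with unit steps that never repeats a value cannot turn back. -/
theorem eq_add_or_add_eq_of_steps {φ : ℕ → ℕ} {m : ℕ}
    (hstep : ∀ i < m, φ i + 1 = φ (i + 1) ∨ φ (i + 1) + 1 = φ i)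
    (hinj : ∀ i ≤ m, ∀ j ≤ m, φ i = φ j → i = j) :
    (∀ i ≤ m, φ i = φ 0 + i) ∨ (∀ i ≤ m, φ i + i = φ 0) := by
  induction m with
  | zero => exact Or.inl fun i hi => by rw [show i = 0 by omega]; rfl
  | succ m ih =>
    have h1 := hstep m (by omega)
    have hcase : ∀ i ≤ m + 1, i ≤ m ∨ i = m + 1 := fun i hi => by omega
    have h2 : m = 0 ∨ φ (m - 1) ≠ φ (m + 1) := by
      by_cases hm : m = 0
      · exact Or.inl hm
      · right
        intro he
        have := hinj _ (by omega) _ (by omega) he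
        omega
    rcases ih (fun i hi => hstep i (by omega))
      (fun i hi j hj => hinj i (by omega) j (by omega)) with h | h
    · have e1 := h m le_rfl
      have e2 := h (m - 1) (by omega)
      by_cases hm : m = 0
      · subst hm
        rcases h1 with h1 | h1
        · left
          intro i hi
          obtain rfl | rfl : i = 0 ∨ i = 1 := by omega
          · rfl
          · exact h1.symm
        · right
          intro i hi
          obtain rfl | rfl : i = 0 ∨ i = 1 := by omega
          · rfl
          · exact h1
      · left
        intro i hi
        rcases hcase i hi with h3 | rfl
        · exact h i h3
        · omega
    · have e1 := h m le_rfl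
      have e2 := h (m - 1) (by omega)
      by_cases hm : m = 0
      · subst hm
        rcases h1 with h1 | h1
        · left
          intro i hi
          obtain rfl | rfl : i = 0 ∨ i = 1 := by omega
          · rfl
          · exact h1.symm
        · right
          intro i hi
          obtain rfl | rfl : i = 0 ∨ i = 1 := by omega
          · rfl
          · exact h1
      · right
        intro i hi
        rcases hcase i hi with h3 | rfl
        · exact h i h3
        · omega

/-- A path of `H - M` runs through the vertices `h l, …, h r` in increasing or decreasing order. -/
theorem IsPathOfHole.exists_run {G : SimpleGraph V} {M : Finset V} {v₀ : V} {H : G.Walk v₀ v₀}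
    {n : ℕ} {h : ℕ → V} (hh : IsHoleSeq G n h) (h0 : h 0 ∈ M)
    (hsup : ∀ v, v ∈ H.support ↔ ∃ i < n, v = h i) {a b : V} {P : G.Walk a b}
    (hP : IsPathOfHole M H P) :
    ∃ l r, IsRun M n h l r ∧ r = l + P.length ∧
      ((∀ i ≤ P.length, P.getVert i = h (l + i)) ∨ ∀ i ≤ P.length, P.getVert i = h (r - i)) := by
  obtain ⟨hp, hsub, -, hcl⟩ := hP
  have hφ : ∀ i, ∃ j < n, P.getVert i = h j ∧ h j ∉ M := by
    intro i
    obtain ⟨h1, h2⟩ := hsub (P.getVert_mem_support i)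
    obtain ⟨j, hj, e⟩ := (hsup _).1 h1
    exact ⟨j, hj, e, e ▸ h2⟩
  choose φ hφn hφ hφM using hφ
  have hφ0 : ∀ i, φ i ≠ 0 := fun i e => hφM i (e ▸ h0)
  have hstep : ∀ i < P.length, φ i + 1 = φ (i + 1) ∨ φ (i + 1) + 1 = φ i := by
    intro i hi
    have := P.adj_getVert_succ hi
    rw [hφ, hφ, hh.adj_iff _ (hφn i) _ (hφn (i + 1))] at this
    have := hφ0 i
    have := hφ0 (i + 1)
    omega
  have hinj : ∀ i ≤ P.length, ∀ j ≤ P.length, φ i = φ j → i = j := by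
    intro i hi j hj e
    exact hp.getVert_injOn hi hj (by rw [hφ, hφ, e])
  have hclosed : ∀ i j, j < n → h j ∉ M → G.Adj (h (φ i)) (h j) → ∃ t ≤ P.length, φ t = j := by
    intro i j hj hjM hadj
    have := hcl (P.getVert i) (P.getVert_mem_support i) (h j) ⟨(hsup _).2 ⟨j, hj, rfl⟩, hjM⟩
      (by rw [hφ]; exact hadj)
    obtain ⟨t, ht, htl⟩ := SimpleGraph.Walk.mem_support_iff_exists_getVert.1 this
    rw [hφ] at ht
    exact ⟨t, htl, hh.inj _ (hφn t) _ hj ht⟩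
  have hrun : ∀ l i₀ i₁, φ i₀ = l → φ i₁ = l + P.length →
      (∀ t ≤ P.length, l ≤ φ t ∧ φ t ≤ l + P.length) →
      (∀ j, l ≤ j → j ≤ l + P.length → ∃ t, φ t = j) → IsRun M n h l (l + P.length) := by
    intro l i₀ i₁ e0 e1 hrange hsurj
    have hl1 := hφ0 i₀
    have hl2 := hφn i₁
    refine ⟨by omega, by omega, by omega, ?_, ?_, fun j h1 h2 => ?_⟩
    · by_contra hc
      have hl0 : l - 1 ≠ 0 := fun e => hc (e ▸ h0)
      obtain ⟨t, ht, hte⟩ := hclosed i₀ (l - 1) (by omega) hc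
        ((hh.adj_iff _ (hφn i₀) _ (by omega)).2 (by omega))
      have := hrange t ht
      omega
    · by_contra hc
      push Not at hc
      obtain ⟨t, ht, hte⟩ := hclosed i₁ (l + P.length + 1) (by omega) hc.2
        ((hh.adj_iff _ (hφn i₁) _ (by omega)).2 (by omega))
      have := hrange t ht
      omega
    · obtain ⟨t, rfl⟩ := hsurj j h1 h2
      exact hφM t
  rcases eq_add_or_add_eq_of_steps hstep hinj with hup | hdown
  · refine ⟨φ 0, _, hrun (φ 0) 0 P.length rfl (hup _ le_rfl) (fun t ht => ?_) (fun j h1 h2 => ?_),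
      rfl, Or.inl fun i hi => ?_⟩
    · have := hup t ht
      omega
    · exact ⟨j - φ 0, by rw [hup _ (by omega)]; omega⟩
    · rw [hφ, hup i hi]
  · have e0 := hdown _ le_rfl
    refine ⟨φ P.length, _, hrun (φ P.length) P.length 0 rfl (by omega) (fun t ht => ?_)
      (fun j h1 h2 => ?_), rfl, Or.inr fun i hi => ?_⟩
    · have := hdown t ht
      omega
    · refine ⟨φ P.length + P.length - j, ?_⟩
      have := hdown (φ P.length + P.length - j) (by omega)
      omega
    · have := hdown i hi
      rw [hφ, show φ i = φ P.length + P.length - i by omega]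

theorem IsSegment.exists_run {G : SimpleGraph V} {M : Finset V} {v₀ : V} {H : G.Walk v₀ v₀}
    {T : SimpleGraph (Bag G (V0 M H))} {n : ℕ} {h : ℕ → V} (hh : IsHoleSeq G n h) (h0 : h 0 ∈ M)
    (hsup : ∀ v, v ∈ H.support ↔ ∃ i < n, v = h i) {X : Set V} (hX : IsSegment M H T X) :
    ∃ l r s t, IsRun M n h l r ∧ l ≤ s ∧ s < t ∧ t ≤ r ∧
      (∀ j, s ≤ j → j ≤ t → (IsJunction M H T (h l) (h r) (h j) ↔ j = s ∨ j = t)) ∧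
      X = {v | ∃ j, s ≤ j ∧ j ≤ t ∧ v = h j} := by
  obtain ⟨a, b, P, hP, s, t, hst, ht, hJ, rfl⟩ := hX
  have hPS : ∀ u ∈ P.support, u ∈ V0 M H := fun u hu =>
    ⟨(hP.2.1 hu).2, fun hc => G.loopless.irrefl u (hc u (hP.2.1 hu).1)⟩
  have hlink : Linked G (V0 M H) a b := ⟨P, hPS⟩
  obtain ⟨l, r, hrun, hr, hup | hdown⟩ := hP.exists_run hh h0 hsup
  · have ha : h l = a := by simpa using (hup 0 (by omega)).symm
    have hb : h r = b := by simpa [hr] using (hup _ le_rfl).symm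
    refine ⟨l, r, l + s, l + t, hrun, by omega, by omega, by omega, fun j h1 h2 => ?_, ?_⟩
    · have e := hup (j - l) (by omega)
      rw [show l + (j - l) = j by omega] at e
      rw [ha, hb, ← e, hJ (j - l) (by omega) (by omega)]
      omega
    · ext v
      constructor
      · rintro ⟨i, h1, h2, rfl⟩
        exact ⟨l + i, by omega, by omega, hup i (by omega)⟩
      · rintro ⟨j, h1, h2, rfl⟩
        refine ⟨j - l, by omega, by omega, ?_⟩
        rw [hup _ (by omega), show l + (j - l) = j by omega]
  · have hb : h l = b := by simpa [hr] using (hdown _ le_rfl).symm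
    have ha : h r = a := by simpa using (hdown 0 (by omega)).symm
    refine ⟨l, r, r - t, r - s, hrun, by omega, by omega, by omega, fun j h1 h2 => ?_, ?_⟩
    · have e := hdown (r - j) (by omega)
      rw [show r - (r - j) = j by omega] at e
      have hsymm : IsJunction M H T b a (P.getVert (r - j)) ↔
          IsJunction M H T a b (P.getVert (r - j)) :=
        ⟨fun h => h.symm hlink.symm, fun h => h.symm hlink⟩
      rw [ha, hb, ← e, hsymm, hJ (r - j) (by omega) (by omega)]
      omega
    · ext v
      constructor
      · rintro ⟨i, h1, h2, rfl⟩
        exact ⟨r - i, by omega, by omega, hdown i (by omega)⟩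
      · rintro ⟨j, h1, h2, rfl⟩
        refine ⟨r - j, by omega, by omega, ?_⟩
        rw [hdown _ (by omega), show r - (r - j) = j by omega]

/-- If there are many segments, then some path of the hole contains many junctions. -/
theorem exists_run_of_lt_ncard {G : SimpleGraph V} {M : Finset V} {v₀ : V} {H : G.Walk v₀ v₀}
    {T : SimpleGraph (Bag G (V0 M H))} {n : ℕ} {h : ℕ → V} (hh : IsHoleSeq G n h) (h0 : h 0 ∈ M)
    (hsup : ∀ v, v ∈ H.support ↔ ∃ i < n, v = h i) {N : ℕ}
    (hN : M.card * N < {X : Set V | IsSegment M H T X}.ncard) :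
    ∃ l r, IsRun M n h l r ∧ ∃ J : Finset ℕ, N < J.card ∧
      ∀ i ∈ J, l ≤ i ∧ i ≤ r ∧ IsJunction M H T (h l) (h r) (h i) := by
  classical
  let Q : ℕ → Prop := fun i =>
    ∃ l r, IsRun M n h l r ∧ l ≤ i ∧ i ≤ r ∧ IsJunction M H T (h l) (h r) (h i)
  let J := (Finset.range n).filter Q
  have hJ : ∀ i, i ∈ J ↔ Q i := by
    intro i
    refine ⟨fun hi => (Finset.mem_filter.1 hi).2, fun hi => Finset.mem_filter.2 ⟨?_, hi⟩⟩
    obtain ⟨l, r, hr, -, h2, -⟩ := hi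
    exact Finset.mem_range.2 (lt_of_le_of_lt h2 hr.lt)
  have hseg : ∀ X ∈ {X : Set V | IsSegment M H T X}, _ := fun X hX =>
    IsSegment.exists_run hh h0 hsup hX
  choose! l r s t hrun hls hst htr hiff hXeq using hseg
  have hcard : {X : Set V | IsSegment M H T X}.ncard ≤ J.card := by
    rw [← Set.ncard_coe_finset]
    refine Set.ncard_le_ncard_of_injOn s (fun X hX => ?_) (fun X hX Y hY hXY => ?_)
      J.finite_toSet
    · rw [Finset.mem_coe, hJ]
      have := hst X hX
      have := htr X hX
      exact ⟨l X, r X, hrun X hX, hls X hX, by omega,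
        (hiff X hX _ le_rfl (by omega)).2 (Or.inl rfl)⟩
    · have a1 := hls X hX
      have a2 := hst X hX
      have a3 := htr X hX
      have b1 := hls Y hY
      have b2 := hst Y hY
      have b3 := htr Y hY
      obtain ⟨e1, e2⟩ := (hrun X hX).unique (hrun Y hY) a1 (by omega) (by omega) (by omega)
      have c1 := hiff X hX
      have c2 := hiff Y hY
      rw [e1, e2, hXY] at c1
      -- On a given path the left end determines a segment, whose right end must be the next
      -- junction.
      have e3 : t X = t Y := by
        rcases lt_trichotomy (t X) (t Y) with h1 | h1 | h1
        · have := (c2 (t X) (by omega) h1.le).1 ((c1 (t X) (by omega) le_rfl).2 (Or.inr rfl))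
          omega
        · exact h1
        · have := (c1 (t Y) (by omega) h1.le).1 ((c2 (t Y) (by omega) le_rfl).2 (Or.inr rfl))
          omega
      rw [hXeq X hX, hXeq Y hY, hXY, e3]
  have hQ : ∀ i ∈ J, Q i := fun i hi => (hJ i).1 hi
  choose! l' r' hrun' hl' hr' hjun using hQ
  -- Pigeonhole over the vertices of `M` that precede the paths.
  obtain ⟨x, -, hx⟩ := Finset.exists_lt_card_fiber_of_mul_lt_card_of_maps_to
    (s := J) (t := M) (f := fun i => h (l' i - 1)) (n := N) (fun i hi => (hrun' i hi).pred_mem)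
    (hN.trans_le hcard)
  obtain ⟨i₀, hi₀⟩ := Finset.card_pos.1 (Nat.zero_lt_of_lt hx)
  rw [Finset.mem_filter] at hi₀
  refine ⟨l' i₀, r' i₀, hrun' i₀ hi₀.1, _, hx, fun i hi => ?_⟩
  rw [Finset.mem_filter] at hi
  have r0 := hrun' i₀ hi₀.1
  have r1 := hrun' i hi.1
  have e1 : l' i - 1 = l' i₀ - 1 := by
    have := r0.lt
    have := r1.lt
    have := r0.le
    have := r1.le
    exact hh.inj _ (by omega) _ (by omega) (hi.2.trans hi₀.2.symm)
  have := r0.one_le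
  have := r1.one_le
  have e2 : l' i = l' i₀ := by omega
  have e3 := (r1.unique r0 (i := l' i₀) (by omega) (by rw [← e2]; exact r1.le) le_rfl r0.le).2
  rw [← e2, ← e3]
  exact ⟨hl' i hi.1, hr' i hi.1, hjun i hi.1⟩

/-- A shortest hole can be traversed starting from a vertex of the hole cover. -/
theorem IsShortestHole.exists_seq {G : SimpleGraph V} {M : Finset V} (hM : IsHoleCover G M) {v₀ : V}
    {H : G.Walk v₀ v₀} (hH : IsShortestHole H) :
    ∃ h : ℕ → V, IsShortestHoleSeq G H.length h ∧ h 0 ∈ M ∧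
      ∀ v, v ∈ H.support ↔ ∃ i < H.length, v = h i := by
  have hseq := hH.1.isHoleSeq
  have h4 := hseq.four_le
  have hs : IsShortestHoleSeq G H.length H.getVert := by
    refine ⟨hseq, fun n' g hg => ?_⟩
    obtain ⟨W, hW, hl, -⟩ := hg.exists_walk
    exact hl ▸ hH.2 _ W hW
  obtain ⟨c, hc, hcM⟩ : ∃ c < H.length, H.getVert c ∈ M := by
    by_contra hno
    push Not at hno
    exact isChordal_induce_iff.1 hM ⟨_, _, hseq, hno⟩
  refine ⟨_, hs.rotate hc, by simpa [Nat.mod_eq_of_lt hc] using hcM, fun v => ⟨fun hv => ?_, ?_⟩⟩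
  · obtain ⟨j, hj, rfl⟩ : ∃ j < H.length, v = H.getVert j := by
      obtain ⟨j, rfl, hj⟩ := SimpleGraph.Walk.mem_support_iff_exists_getVert.1 hv
      rcases hj.lt_or_eq with h1 | rfl
      · exact ⟨j, h1, rfl⟩
      · exact ⟨0, by omega, by simp⟩
    rcases Nat.lt_or_ge j c with h1 | h1
    · refine ⟨j + H.length - c, by omega, ?_⟩
      rw [show j + H.length - c + c = j + H.length by omega, Nat.add_mod_right,
        Nat.mod_eq_of_lt hj]
    · refine ⟨j - c, by omega, ?_⟩
      rw [show j - c + c = j by omega, Nat.mod_eq_of_lt hj]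
  · rintro ⟨i, -, rfl⟩
    exact H.getVert_mem_support _

end ChordalEditing

/-! ### The main theorem -/

theorem theorem3 {V : Type*} [Finite V] (G : SimpleGraph V) (k k₁ k₂ k₃ : ℕ)
    (hk : k = k₁ + k₂ + k₃) (M : Finset V) (hMcard : M.card ≤ k + 1)
    (hM : ChordalEditing.IsHoleCover G M)
    {r : V} (H : G.Walk r r) (hH : ChordalEditing.IsShortestHole H) (hlen : k + 4 ≤ H.length)
    (T : SimpleGraph (ChordalEditing.Bag G (ChordalEditing.V0 M H)))
    (hT : ChordalEditing.IsCliqueTree G (ChordalEditing.V0 M H) T)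
    (hseg : M.card * (12 * k ^ 2 + 87 * k + 75) <
      {X : Set V | ChordalEditing.IsSegment M H T X}.ncard) :
    (∃ v : V, v ∉ M ∧ ∀ (Vd : Finset V) (Ed Ea : Finset (Sym2 V)),
        ChordalEditing.IsSolution G k₁ k₂ k₃ M Vd Ed Ea → v ∈ Vd) ∨
      ¬ ∃ (Vd : Finset V) (Ed Ea : Finset (Sym2 V)),
        ChordalEditing.IsSolution G k₁ k₂ k₃ M Vd Ed Ea := by
  obtain ⟨h, hs, h0, hsup⟩ := hH.exists_seq hM
  rcases Nat.eq_zero_or_pos k with rfl | hkpos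
  · refine Or.inr fun ⟨Vd, Ed, Ea, hsol⟩ => ?_
    -- For `k = 0` nothing may be edited, so the hole itself excludes a solution. For positive `k`
    -- the hole has length at least five, as the other case requires.
    have := hsol.card_le ({0} : Finset ℕ) (fun _ => Set.univ) ∅
      (fun _ _ => ⟨_, h, hs.isHoleSeq, fun _ _ => trivial⟩) (by simp) (by simp) (by simp)
    rw [Finset.card_singleton] at this
    omega
  · obtain ⟨l, r', hrun, J, hJ, hJun⟩ :=
      ChordalEditing.exists_run_of_lt_ncard hs.isHoleSeq h0 hsup hseg
    have hset : ChordalEditing.HoleSetting G M H.length h l r' :=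
      ⟨hs, by omega, ChordalEditing.isChordal_induce_iff.1 hM, hrun.lt, hrun.one_le, hrun.notMem⟩
    refine hset.exists_forced_of_junctions (T := T) ?_ hk hMcard J hJun hJ
    ext a
    constructor
    · exact fun ha i hi => ha _ ((hsup _).2 ⟨i, hi, rfl⟩)
    · rintro ha v hv
      obtain ⟨i, hi, rfl⟩ := (hsup v).1 hv
      exact ha i hi
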